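/- **Conventions.** A *2-crossed module* $\mathcal A=(L\xrightarrow{\delta}E\xrightarrow{\partial}G,\triangleright,\{,\})$ consists of groups $L,E,G$, left actions $\triangleright$ of $G$ by automorphisms on $E$ and $L$ (and on $G$ by conjugation), $G$-equivariant homomorphisms $\delta,\partial$ with $\partial\delta=1$, and a $G$-equivariant map $\{,\}:E\times E\to L$ such that, with $e\triangleright' l:=l\{\delta(l)^{-1},e\}$: $\delta\{e,f\}=efe^{-1}(\partial(e)\triangleright f^{-1})$; $\{\delta l,\delta k\}=lkl^{-1}k^{-1}$; $\{\delta l,e\}\{e,\delta l\}=l(\partial(e)\triangleright l^{-1})$; $\{ef,g\}=\{e,fgf^{-1}\}\,\partial(e)\triangleright\{f,g\}$; $\{e,fg\}=\{e,f\}\,(\partial(e)\triangleright f)\triangleright'\{e,g\}$. A (strict) map $f=(\mu,\psi,\phi):\mathcal A\to\mathcal A'$ is a triple of homomorphisms $L\to L'$, $E\to E'$, $G\to G'$ commuting with $\delta,\partial$, the actions and $\{,\}$. A 2-groupoid is a strict 2-category in which all 1-morphisms are (strictly) invertible and all 2-morphisms are invertible. Compositions are written in diagrammatic order. **Strict homotopies.**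 Let $f,f'=(\mu',\psi',\phi'):\mathcal A\to\mathcal A'$ be maps. A *homotopy* $(f,s,t):f\to f'$ is a pair of maps $s:G\to E'$, $t:E\to L'$ with $s(gh)=(\phi(h)^{-1}\triangleright s(g))\,s(h)$, $t(ab)=\big(\psi(b)s(\partial b)\big)^{-1}\triangleright'\big(\{\psi(b),\phi(\partial b)^{-1}\triangleright s(\partial a)^{-1}\}\,t(a)\big)\,t(b)$, $t(g\triangleright a)=\phi(g)\triangleright\big((s(g)s(\partial a)^{-1})\triangleright'\{\psi(a)^{-1},s(g)^{-1}\}^{-1}\big)\;\phi(g)\triangleright\{s(g),s(\partial a)^{-1}\psi(a)^{-1}\}\;(\phi(g)\,\partial s(g))\triangleright t(a)$, and $\phi'(g)=\phi(g)\,\partial s(g)$, $\psi'(e)=\psi(e)\,s(\partial e)\,\delta t(e)$, $\mu'(l)=\mu(l)\,t(\delta l)$. A *2-fold homotopy* $(f,s,t)\to(f,s',t')$ between homotopies $f\to f'$ is a map $k:G\to L'$ with $k(gh)=\big(s(h)^{-1}\triangleright'(\phi(h)^{-1}\triangleright k(g))\big)k(h)$, $s'(g)=s(g)\delta k(g)$,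 $t'(e)=k(\partial e)^{-1}t(e)$. If $G$ is free on a basis $B$, then $\mathrm{HOM}_B(\mathcal A,\mathcal A')$ has the maps, homotopies and 2-fold homotopies as objects, 1- and 2-morphisms; identities are trivial ($s=1,t=1$; $k=1$). The concatenation $(s\otimes s',t\otimes t')$ of $(f,s,t):f\to f'$ and $(f',s',t'):f'\to f''$ is determined by $(s\otimes s')(b)=s(b)s'(b)$ for $b\in B$ and $(t\otimes t')(e)=\omega(\partial e)\;\big(s'(\partial e)^{-1}\triangleright' t(e)\big)\;t'(e)$, where $\omega(g)$ is the last component of $X(g)$ and $X:G\to (G'\ltimes E')\ltimes_\bullet(E'\ltimes_{\triangleright'}L')$ is the group morphism with $X(b)=(\phi(b),s(b),s'(b),1)$ for $b\in B$; here $(g,e)\bullet(z,w)=(g\triangleright(eze^{-1}),\,g\triangleright(\{e,z^{-1}\}\,\partial(e)\triangleright w))$ and a semidirect product $H\ltimes K$ has product $(h,k)(h',k')=(hh',(h'^{-1}\cdot k)k')$. Vertical composition is $k\diamond k'=kk'$ (pointwise); for $b\in B$, right whiskering by $(f',s'',t'')$ is $(k\otimes s'')(b)=s''(b)^{-1}\triangleright'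 k(b)$ and left whiskering is $(s''\otimes k)(b)=k(b)$. **The resolution.** Let $F(G)$ be the free group on the set $\{[g]:g\in G\}$ and $p:F(G)\to G$, $[g]\mapsto g$. Put $Q^1(\mathcal A)=(L\to E\times_G F(G)\to F(G))$, where $E\times_GF(G)=\{(e,u):\partial e=p(u)\}$, $\delta'(l)=(\delta l,1)$, $\partial'(e,u)=u$, $u\triangleright(e,u')=(p(u)\triangleright e,uu'u^{-1})$, $u\triangleright l=p(u)\triangleright l$, $\{(e,u),(e',u')\}=\{e,e'\}$; let $\mathrm{proj}:Q^1(\mathcal A)\to\mathcal A$ be the projection, and $[G]$ the basis $\{[g]\}$. **Lax homotopies.** Let $f_1=(\mu_1,\psi_1,\phi_1)$ and $f_2=(\mu_2,\psi_2,\phi_2)$ be maps $\mathcal A\to\mathcal A'$. A *lax homotopy* $(f_1,\hat s,\hat t,\Pi):f_1\to f_2$ consists of maps of sets $\hat s:G\to E'$, $\hat t:E\to L'$, $\Pi:G\times G\to L'$ such that for all $g,h,i\in G$, $a,b,e\in E$, $l\in L$: 1. $\partial\hat s(gh)=\partial\big(\phi_1(h)^{-1}\triangleright\hat s(g)\;\hat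 s(h)\big)$ and $\hat s(gh)=\phi_1(h)^{-1}\triangleright\hat s(g)\;\hat s(h)\;\delta\Pi(g,h)$; 2. $\Pi(\partial a,\partial b)\,\hat t(ab)=\hat s(\partial b)^{-1}\triangleright'\big(\{\psi_1(b)^{-1},\hat s(\partial a)^{-1}\}^{-1}\;\psi_1(b)^{-1}\triangleright'\hat t(a)\big)\;\hat t(b)$; 3. $\phi_1(g)\triangleright\big((\hat s(g)\hat s(\partial a)^{-1})\triangleright'\{\psi_1(a)^{-1},\hat s(g)^{-1}\}^{-1}\big)\;\phi_1(g)\triangleright\{\hat s(g),\hat s(\partial a)^{-1}\psi_1(a)^{-1}\}\;(\phi_1(g)\,\partial\hat s(g))\triangleright\hat t(a)=\Pi(1,1)^{-1}\,\Pi(g,g^{-1})^{-1}\,\Pi(\partial a,g^{-1})\,\Pi(g,\partial(a)g^{-1})\,\hat t(g\triangleright a)$; 4. $\hat s(i)^{-1}\triangleright'\big(\phi_1(i)^{-1}\triangleright\Pi(g,h)\big)\;\Pi(gh,i)=\Pi(h,i)\,\Pi(g,hi)$; 5. $\phi_2(g)=\phi_1(g)\,\partial\hat s(g)$, $\psi_2(e)=\psi_1(e)\,\hat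 s(\partial e)\,\delta\hat t(e)$, $\mu_2(l)=\mu_1(l)\,\Pi(1,1)^{-1}\,\hat t(\delta l)$. A *lax 2-fold homotopy* $(f,\hat s,\hat t,\Pi)\to(f,\hat s',\hat t',\Pi')$ between lax homotopies $f\to f'$, $f=(\mu,\psi,\phi)$, is an arbitrary map $\hat k:G\to L'$ such that $\hat s'(g)=\hat s(g)\,\delta\hat k(g)$, $\hat t'(e)=\hat k(\partial e)^{-1}\,\hat t(e)$ and $\Pi'(g,h)=\Xi(gh,g,h)^{-1}\,\Pi(g,h)$, where $$\Xi(a,b,c)=\hat s(c)^{-1}\triangleright'\Big(\phi(c)^{-1}\triangleright\big(\hat s(b)^{-1}\triangleright'\big((\phi(b)^{-1}\phi(a))\triangleright(\hat s(a)\triangleright'\hat k(a)^{-1})\big)\;\hat k(b)\big)\Big)\;\hat k(c).$$ **Theorem.** For all 2-crossed modules $\mathcal A$ and $\mathcal A'$ there is a 2-groupoid $\mathrm{HOM}_{\rm LAX}(\mathcal A,\mathcal A')$ whose objects are the maps $\mathcal A\to\mathcal A'$, whose 1-morphisms are the lax homotopies and whose 2-morphisms are the lax 2-fold homotopies, with the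 following operations. * Identities: $\hat s=1$, $\hat t=1$, $\Pi=1$; and $\hat k=1$ for 2-morphisms. * The concatenation of $(f,\hat s,\hat t,\Pi):f\to f'$ and $(f',\hat s',\hat t',\Pi'):f'\to f''$ is given by $\hat s(g)\hat s'(g)$, by $\hat s'(\partial e)^{-1}\triangleright'\hat t(e)\;\hat t'(e)$, and by $\Theta^{(\hat s,\hat s')}(gh,g,h)\,\Pi'(g,h)\,\Pi(g,h)$, where, with $\phi,\phi'$ the components $G\to G'$ of $f,f'$, $$\Theta^{(s,s')}(a,b,c)=s'(c)^{-1}\triangleright'\{s(c)^{-1},\phi(c)^{-1}\triangleright s'(b)^{-1}\}\;\big(\phi'(c)^{-1}\triangleright s'(b)\;s'(c)\big)^{-1}\triangleright'\Big(\big\{\big(\phi(c)^{-1}\triangleright s(b)\;s(c)\big)^{-1},(\phi(bc)^{-1}\phi(a))\triangleright(s(a)s'(a)s(a)^{-1})\big\}\;(\phi'(bc)^{-1}\phi(a))\triangleright\{s(a),s'(a)\}\Big).$$ * The inverse of $(f,\hat s,\hat t,\Pi):f\to f'$ is given by $\hat s(g)^{-1}$, $\hat s(\partial e)\triangleright'\hat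 t(e)^{-1}$ and $\Theta^{(\hat s,\hat s^{-1})}(gh,g,h)^{-1}\,\Pi(g,h)^{-1}$, where $\hat s^{-1}(g)=\hat s(g)^{-1}$. * Vertical composition: $(\hat k\diamond\hat k')(g)=\hat k(g)\hat k'(g)$. Right whiskering by $(f',\hat s'',\hat t'',\Pi'')$: $g\mapsto\hat s''(g)^{-1}\triangleright'\hat k(g)$. Left whiskering by any lax homotopy: $g\mapsto\hat k(g)$. Moreover $\mathrm{HOM}_{[G]}(Q^1(\mathcal A),\mathcal A')$, with the operations above, is a 2-groupoid, and $\mathrm{HOM}_{\rm LAX}(\mathcal A,\mathcal A')$ is its full sub-2-groupoid on the strict maps: there is a strict 2-functor $\mathrm{HOM}_{\rm LAX}(\mathcal A,\mathcal A')\to\mathrm{HOM}_{[G]}(Q^1(\mathcal A),\mathcal A')$ which is $f\mapsto f\circ\mathrm{proj}$ on objects, is injective on objects, is bijective on 1-morphisms between any two objects and on 2-morphisms between any two 1-morphisms, and sends $(f,\hat s,\hat t,\Pi)$ to $(f\circ\mathrm{proj},s,t)$ and $\hat k$ to $k$ with $s([g])=\hat s(g)$, $t(e,[\partial e])=\hat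 t(e)$, $t(1,[gh]^{-1}[g][h])=\Pi(g,h)$, $k([g])=\hat k(g)$ for all $g,h\in G$, $e\in E$. -/

import Mathlib

open CategoryTheory

universe u v w

/-- A 2-crossed module of groups `L --δ--> E --bd--> G`: `G` acts on `E` and `L` by automorphisms
(and on itself by conjugation), and `pl e f = {e, f}` is the Peiffer lifting. -/
structure TwoCrossedModule where
  /-- the underlying group -/
  G : Type u
  /-- the principal group -/
  E : Type u
  /-- the top group -/
  L : Type u
  [groupG : Group G]
  [groupE : Group E]
  [groupL : Group L]
  [actE : MulDistribMulAction G E]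
  [actL : MulDistribMulAction G L]
  δ : L →* E
  bd : E →* G
  pl : E → E → L
  bd_δ : ∀ l, bd (δ l) = 1
  δ_smul : ∀ (g : G) (l : L), δ (g • l) = g • δ l
  bd_smul : ∀ (g : G) (e : E), bd (g • e) = g * bd e * g⁻¹
  smul_pl : ∀ (g : G) (e f : E), g • pl e f = pl (g • e) (g • f)
  δ_pl : ∀ e f : E, δ (pl e f) = e * f * e⁻¹ * (bd e • f⁻¹)
  pl_δ_δ : ∀ l k : L, pl (δ l) (δ k) = l * k * l⁻¹ * k⁻¹
  pl_δ_mul_pl_δ : ∀ (e : E) (l : L), pl (δ l) e * pl e (δ l) = l * (bd e • l⁻¹)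
  pl_mul_left : ∀ e f g : E, pl (e * f) g = pl e (f * g * f⁻¹) * (bd e • pl f g)
  /-- `{e, fg} = {e, f} · ((∂e ▷ f) ▷' {e, g})`, where `x ▷' l = l · {δ(l)⁻¹, x}`. -/
  pl_mul_right : ∀ e f g : E,
    pl e (f * g) = pl e f * (pl e g * pl (δ (pl e g))⁻¹ (bd e • f))

namespace TwoCrossedModule

attribute [instance] groupG groupE groupL actE actL

/-- The secondary action `e ▷' l = l · {δ(l)⁻¹, e}` of `E` on `L`. -/
def sec (A : TwoCrossedModule.{u}) (e : A.E) (l : A.L) : A.L :=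
  l * A.pl (A.δ l)⁻¹ e

/-- A (strict) morphism of 2-crossed modules. -/
@[ext]
structure Hom (A : TwoCrossedModule.{u}) (A' : TwoCrossedModule.{v}) where
  μ : A.L →* A'.L
  ψ : A.E →* A'.E
  φ : A.G →* A'.G
  ψ_δ : ∀ l, ψ (A.δ l) = A'.δ (μ l)
  φ_bd : ∀ e, φ (A.bd e) = A'.bd (ψ e)
  μ_pl : ∀ e f, μ (A.pl e f) = A'.pl (ψ e) (ψ f)
  μ_smul : ∀ (g : A.G) (l : A.L), μ (g • l) = φ g • μ l
  ψ_smul : ∀ (g : A.G) (e : A.E), ψ (g • e) = φ g • ψ e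

/-- Composition: `f.comp g` is `f ∘ g`. -/
def Hom.comp {A : TwoCrossedModule.{u}} {A' : TwoCrossedModule.{v}} {A'' : TwoCrossedModule.{w}}
    (f : Hom A' A'') (g : Hom A A') : Hom A A'' where
  μ := f.μ.comp g.μ
  ψ := f.ψ.comp g.ψ
  φ := f.φ.comp g.φ
  ψ_δ l := by simp [g.ψ_δ, f.ψ_δ]
  φ_bd e := by simp [g.φ_bd, f.φ_bd]
  μ_pl e e' := by simp [g.μ_pl, f.μ_pl]
  μ_smul a l := by simp [g.μ_smul, f.μ_smul]
  ψ_smul a e := by simp [g.ψ_smul, f.ψ_smul]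

/-! ### Strict homotopies and 2-fold homotopies -/

section Strict

variable {A : TwoCrossedModule.{u}} {A' : TwoCrossedModule.{v}}

/-- Quadratic `f`-derivations `(s, t)`. -/
structure IsQuadraticDerivation (f : Hom A A') (s : A.G → A'.E) (t : A.E → A'.L) : Prop where
  s_mul : ∀ g h, s (g * h) = ((f.φ h)⁻¹ • s g) * s h
  t_mul : ∀ a b, t (a * b) =
    A'.sec (f.ψ b * s (A.bd b))⁻¹
      (A'.pl (f.ψ b) ((f.φ (A.bd b))⁻¹ • (s (A.bd a))⁻¹) * t a) * t b
  t_smul : ∀ (g : A.G) (a : A.E), t (g • a) =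
    (f.φ g • A'.sec (s g * (s (A.bd a))⁻¹) (A'.pl (f.ψ a)⁻¹ (s g)⁻¹)⁻¹) *
      (f.φ g • A'.pl (s g) ((s (A.bd a))⁻¹ * (f.ψ a)⁻¹)) *
      ((f.φ g * A'.bd (s g)) • t a)

/-- A (1-fold, pointed) homotopy `(f, s, t) : f ⟶ f'`. -/
@[ext]
structure Htpy (f f' : Hom A A') where
  s : A.G → A'.E
  t : A.E → A'.L
  isQuadraticDerivation : IsQuadraticDerivation f s t
  μ_eq : ∀ l, f'.μ l = f.μ l * t (A.δ l)
  ψ_eq : ∀ e, f'.ψ e = f.ψ e * s (A.bd e) * A'.δ (t e)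
  φ_eq : ∀ g, f'.φ g = f.φ g * A'.bd (s g)

/-- A 2-fold homotopy `(f, s, t, k) : (f, s, t) ⟶ (f, s', t')`, given by a quadratic
`(f, s, t)` 2-derivation `k`. -/
@[ext]
structure Htpy₂ {f f' : Hom A A'} (h h' : Htpy f f') where
  k : A.G → A'.L
  k_mul : ∀ a b, k (a * b) = A'.sec (h.s b)⁻¹ ((f.φ b)⁻¹ • k a) * k b
  s_eq : ∀ g, h'.s g = h.s g * A'.δ (k g)
  t_eq : ∀ e, h'.t e = (k (A.bd e))⁻¹ * h.t e

/-- The underlying set of the underlying group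
`(G ⋉ E) ⋉_• ({1} ⋉_* (E ⋉_{▷'} L))` of the triangle space of `A`; the quadruple
`(g, x, z, w)` stands for `(g, x, 1, z, w)`. -/
@[ext]
structure Triangle (A : TwoCrossedModule.{u}) where
  g : A.G
  x : A.E
  z : A.E
  w : A.L

/-- The lifted action
`(g, x) • (1, e, k) = (1, g ▷ (x e x⁻¹), g ▷ ({x, e⁻¹} · ∂(x) ▷ k))` of `G ⋉ E`. -/
def liftedAct (A : TwoCrossedModule.{u}) (g : A.G) (x : A.E) (ek : A.E × A.L) : A.E × A.L :=
  (g • (x * ek.1 * x⁻¹), g • (A.pl x ek.1⁻¹ * (A.bd x • ek.2)))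

/-- The product of the semidirect product `E ⋉_{▷'} L`. -/
def semiMul (A : TwoCrossedModule.{u}) (p q : A.E × A.L) : A.E × A.L :=
  (p.1 * q.1, A.sec q.1⁻¹ p.2 * q.2)

/-- The group law of the underlying group of the triangle space; with the convention
`(g, e)(g', e') = (g g', (g'⁻¹ ▷ e) e')` for semidirect products, so that
`(g, x)⁻¹ = (g⁻¹, g ▷ x⁻¹)` in `G ⋉ E`. -/
instance (A : TwoCrossedModule.{u}) : Mul (Triangle A) where
  mul X Y :=
    let p := A.semiMul (A.liftedAct Y.g⁻¹ (Y.g • Y.x⁻¹) (X.z, X.w)) (Y.z, Y.w)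
    ⟨X.g * Y.g, (Y.g⁻¹ • X.x) * Y.x, p.1, p.2⟩

/-- `h''` is the concatenation `h ⊗ h'` with respect to the free basis `b` of `A.G`: if
`X : A.G → Gr₀(T(A'))` is the unique group morphism with
`X(b) = (φ(b), s(b), 1, s'(b), 1)` on basis elements, and `ω` is its last component, then
`s ⊗ s'` is the derivation with `(s ⊗ s')(b) = s(b) s'(b)` on basis elements and
`(t ⊗ t')(e) = ω(∂e) · (s'(∂e)⁻¹ ▷' t(e)) · t'(e)`. -/
def IsConcat {ι : Type u} (b : FreeGroupBasis ι A.G) {f f' f'' : Hom A A'}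
    (h : Htpy f f') (h' : Htpy f' f'') (h'' : Htpy f f'') : Prop :=
  (∀ i, h''.s (b i) = h.s (b i) * h'.s (b i)) ∧
  ∃ X : A.G →ₙ* Triangle A',
    (∀ i, X (b i) = ⟨f.φ (b i), h.s (b i), h'.s (b i), 1⟩) ∧
    ∀ e, h''.t e = (X (A.bd e)).w * A'.sec (h'.s (A.bd e))⁻¹ (h.t e) * h'.t e

end Strict

/-! ### Lax homotopies and lax 2-fold homotopies -/

section Lax

variable {A : TwoCrossedModule.{u}} {A' : TwoCrossedModule.{v}}

/-- A (pointed) lax homotopy `(f₁, s, t, P) : f₁ ⟶ f₂`. -/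
@[ext]
structure LaxHtpy (f₁ f₂ : Hom A A') where
  s : A.G → A'.E
  t : A.E → A'.L
  P : A.G → A.G → A'.L
  bd_s_mul : ∀ g h, A'.bd (s (g * h)) = A'.bd (((f₁.φ h)⁻¹ • s g) * s h)
  s_mul : ∀ g h, s (g * h) = ((f₁.φ h)⁻¹ • s g) * s h * A'.δ (P g h)
  t_mul : ∀ a b, P (A.bd a) (A.bd b) * t (a * b) =
    A'.sec (s (A.bd b))⁻¹
      ((A'.pl (f₁.ψ b)⁻¹ (s (A.bd a))⁻¹)⁻¹ * A'.sec (f₁.ψ b)⁻¹ (t a)) * t b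
  t_smul : ∀ (g : A.G) (a : A.E),
    (f₁.φ g • A'.sec (s g * (s (A.bd a))⁻¹) (A'.pl (f₁.ψ a)⁻¹ (s g)⁻¹)⁻¹) *
        (f₁.φ g • A'.pl (s g) ((s (A.bd a))⁻¹ * (f₁.ψ a)⁻¹)) *
        ((f₁.φ g * A'.bd (s g)) • t a) =
      (P 1 1)⁻¹ * (P g g⁻¹)⁻¹ * P (A.bd a) g⁻¹ * P g (A.bd a * g⁻¹) * t (g • a)
  P_cocycle : ∀ g h i,
    A'.sec (s i)⁻¹ ((f₁.φ i)⁻¹ • P g h) * P (g * h) i = P h i * P g (h * i)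
  φ_eq : ∀ g, f₂.φ g = f₁.φ g * A'.bd (s g)
  ψ_eq : ∀ e, f₂.ψ e = f₁.ψ e * s (A.bd e) * A'.δ (t e)
  μ_eq : ∀ l, f₂.μ l = f₁.μ l * (P 1 1)⁻¹ * t (A.δ l)

/-- `Ξ^{(φ,s,k)}(a, b, c)`, the value of a 2-derivation at `a⁻¹ b c`. -/
def Xi (φ : A.G →* A'.G) (s : A.G → A'.E) (k : A.G → A'.L) (a b c : A.G) : A'.L :=
  A'.sec (s c)⁻¹ ((φ c)⁻¹ •
    (A'.sec (s b)⁻¹ (((φ b)⁻¹ * φ a) • A'.sec (s a) (k a)⁻¹) * k b)) * k c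

/-- `Θ^{(s,s')}(a, b, c)`, for maps `s`, `s'` over `φ`, `φ'`. -/
def Theta (φ φ' : A.G →* A'.G) (s s' : A.G → A'.E) (a b c : A.G) : A'.L :=
  A'.sec (s' c)⁻¹ (A'.pl (s c)⁻¹ ((φ c)⁻¹ • (s' b)⁻¹)) *
  A'.sec (((φ' c)⁻¹ • s' b) * s' c)⁻¹
    (A'.pl (((φ c)⁻¹ • s b) * s c)⁻¹ (((φ (b * c))⁻¹ * φ a) • (s a * s' a * (s a)⁻¹)) *
      (((φ' (b * c))⁻¹ * φ a) • A'.pl (s a) (s' a)))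

/-- A (pointed) lax 2-fold homotopy between lax homotopies `f ⟶ f'`: an arbitrary map
`k : G → L'` relating the two lax homotopies. -/
@[ext]
structure LaxHtpy₂ {f f' : Hom A A'} (h h' : LaxHtpy f f') where
  k : A.G → A'.L
  s_eq : ∀ g, h'.s g = h.s g * A'.δ (k g)
  t_eq : ∀ e, h'.t e = (k (A.bd e))⁻¹ * h.t e
  P_eq : ∀ a b, h'.P a b = (Xi f.φ h.s k (a * b) a b)⁻¹ * h.P a b

end Lax

/-! ### The partial resolution `Q¹(A)` -/

section Resolution

variable (A : TwoCrossedModule.{u})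

/-- The projection `p : F(G) → G`, `[g] ↦ g`, from the free group on the underlying set of `G`. -/
def freeProj : FreeGroup A.G →* A.G := FreeGroup.lift id

/-- The pullback `E ×_G F(G)`. -/
def pullback : Subgroup (A.E × FreeGroup A.G) :=
  (A.bd.comp (MonoidHom.fst A.E (FreeGroup A.G))).eqLocus
    (A.freeProj.comp (MonoidHom.snd A.E (FreeGroup A.G)))

theorem mem_pullback (x : A.E × FreeGroup A.G) :
    x ∈ A.pullback ↔ A.bd x.1 = A.freeProj x.2 := Iff.rfl

/-- `u ▷ (e, u') = (p(u) ▷ e, u u' u⁻¹)`. -/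
instance pullbackAction : MulDistribMulAction (FreeGroup A.G) A.pullback where
  smul u x := ⟨(A.freeProj u • x.1.1, u * x.1.2 * u⁻¹), by
    have h := (A.mem_pullback _).1 x.2
    rw [mem_pullback]
    simp [A.bd_smul, h]⟩
  one_smul x := by
    apply Subtype.ext
    apply Prod.ext
    · change A.freeProj 1 • x.1.1 = x.1.1
      simp
    · change 1 * x.1.2 * 1⁻¹ = x.1.2
      simp
  mul_smul u v x := by
    apply Subtype.ext
    apply Prod.ext
    · change A.freeProj (u * v) • x.1.1 = A.freeProj u • A.freeProj v • x.1.1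
      simp [mul_smul]
    · change u * v * x.1.2 * (u * v)⁻¹ = u * (v * x.1.2 * v⁻¹) * u⁻¹
      group
  smul_mul u x y := by
    apply Subtype.ext
    apply Prod.ext
    · change A.freeProj u • (x.1.1 * y.1.1) = (A.freeProj u • x.1.1) * (A.freeProj u • y.1.1)
      simp
    · change u * (x.1.2 * y.1.2) * u⁻¹ = (u * x.1.2 * u⁻¹) * (u * y.1.2 * u⁻¹)
      group
  smul_one u := by
    apply Subtype.ext
    apply Prod.ext
    · change A.freeProj u • (1 : A.E) = 1
      simp
    · change u * 1 * u⁻¹ = 1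
      simp

/-- `Q¹(A) = (L → E ×_G F(G) → F(G))`. -/
def Q1 : TwoCrossedModule.{u} where
  G := FreeGroup A.G
  E := A.pullback
  L := A.L
  actL := MulDistribMulAction.compHom A.L A.freeProj
  δ :=
    { toFun := fun l => ⟨(A.δ l, 1), by rw [mem_pullback]; simp [A.bd_δ]⟩
      map_one' := by apply Subtype.ext; simp
      map_mul' := fun l k => by apply Subtype.ext; simp }
  bd := (MonoidHom.snd A.E (FreeGroup A.G)).comp A.pullback.subtype
  pl x y := A.pl x.1.1 y.1.1
  bd_δ l := rfl
  δ_smul u l := by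
    apply Subtype.ext
    apply Prod.ext
    · exact A.δ_smul (A.freeProj u) l
    · change 1 = u * 1 * u⁻¹
      simp
  bd_smul u x := rfl
  smul_pl u x y := A.smul_pl (A.freeProj u) x.1.1 y.1.1
  δ_pl x y := by
    apply Subtype.ext
    apply Prod.ext
    · change A.δ (A.pl x.1.1 y.1.1) =
        x.1.1 * y.1.1 * x.1.1⁻¹ * (A.freeProj x.1.2 • y.1.1⁻¹)
      rw [A.δ_pl, (A.mem_pullback _).1 x.2]
    · change 1 = x.1.2 * y.1.2 * x.1.2⁻¹ * (x.1.2 * y.1.2⁻¹ * x.1.2⁻¹)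
      group
  pl_δ_δ l k := A.pl_δ_δ l k
  pl_δ_mul_pl_δ x l := by
    change A.pl (A.δ l) x.1.1 * A.pl x.1.1 (A.δ l) = l * (A.freeProj x.1.2 • l⁻¹)
    rw [A.pl_δ_mul_pl_δ, (A.mem_pullback _).1 x.2]
  pl_mul_left x y z := by
    change A.pl (x.1.1 * y.1.1) z.1.1 =
      A.pl x.1.1 (y.1.1 * z.1.1 * y.1.1⁻¹) * (A.freeProj x.1.2 • A.pl y.1.1 z.1.1)
    rw [A.pl_mul_left, (A.mem_pullback _).1 x.2]
  pl_mul_right x y z := by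
    change A.pl x.1.1 (y.1.1 * z.1.1) = A.pl x.1.1 y.1.1 *
      (A.pl x.1.1 z.1.1 *
        A.pl (A.δ (A.pl x.1.1 z.1.1))⁻¹ (A.freeProj x.1.2 • y.1.1))
    rw [A.pl_mul_right, (A.mem_pullback _).1 x.2]

/-- The projection `Q¹(A) → A`. -/
def proj : Hom A.Q1 A where
  μ := MonoidHom.id A.L
  ψ := (MonoidHom.fst A.E (FreeGroup A.G)).comp A.pullback.subtype
  φ := A.freeProj
  ψ_δ _ := rfl
  φ_bd x := ((A.mem_pullback _).1 x.2).symm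
  μ_pl _ _ := rfl
  μ_smul _ _ := rfl
  ψ_smul _ _ := rfl

/-- The chosen free basis `[G]` of the underlying group of `Q¹(A)`. -/
def Q1basis : FreeGroupBasis A.G A.Q1.G := FreeGroupBasis.ofFreeGroup A.G

/-- The element `(e, [∂e])` of the principal group of `Q¹(A)`. -/
def genE (e : A.E) : A.Q1.E :=
  ⟨(e, FreeGroup.of (A.bd e)), by rw [mem_pullback]; simp [freeProj]⟩

/-- The element `(1, [gh]⁻¹[g][h])` of the principal group of `Q¹(A)`. -/
def genK (g h : A.G) : A.Q1.E :=
  ⟨(1, (FreeGroup.of (g * h))⁻¹ * FreeGroup.of g * FreeGroup.of h), by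
    rw [mem_pullback]; simp [freeProj, mul_assoc]⟩

end Resolution

/-! ### 2-groupoids -/

/-- A 2-groupoid with set of objects `Obj`, sets of 1-morphisms `Cell₁ a b` and sets of
2-morphisms `Cell₂ p q`: a strict 2-category in which all 1-morphisms are invertible (strictly)
and all 2-morphisms are invertible. -/
structure TwoGroupoidOn (Obj : Type u) (Cell₁ : Obj → Obj → Type v)
    (Cell₂ : ∀ ⦃a b : Obj⦄, Cell₁ a b → Cell₁ a b → Type w) where
  bicategory : Bicategory.{w, v} Obj
  strict : Bicategory.Strict Obj
  cell₁ : ∀ {a b : Obj}, (a ⟶ b) ≃ Cell₁ a b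
  cell₂ : ∀ {a b : Obj} {p q : a ⟶ b}, (p ⟶ q) ≃ Cell₂ (cell₁ p) (cell₁ q)
  inv₁ : ∀ {a b : Obj} (p : a ⟶ b), ∃ q : b ⟶ a, p ≫ q = 𝟙 a ∧ q ≫ p = 𝟙 b
  inv₂ : ∀ {a b : Obj} {p q : a ⟶ b} (η : p ⟶ q), IsIso η

section Specification

variable {A : TwoCrossedModule.{u}} {A' : TwoCrossedModule.{v}}

open Bicategory

/-- The operations of the 2-groupoid `HOM_B(A, A')` of 2-crossed module maps, homotopies and
2-fold homotopies, when `A.G` is free on the basis `b`. -/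
structure IsHOM {ι : Type u} (b : FreeGroupBasis ι A.G)
    (S : TwoGroupoidOn (Hom A A') Htpy (fun _ _ => Htpy₂)) : Prop where
  id₁ : letI := S.bicategory
    ∀ f : Hom A A', (∀ g, (S.cell₁ (𝟙 f)).s g = 1) ∧ ∀ e, (S.cell₁ (𝟙 f)).t e = 1
  comp₁ : letI := S.bicategory
    ∀ {f f' f'' : Hom A A'} (p : f ⟶ f') (q : f' ⟶ f''),
      IsConcat b (S.cell₁ p) (S.cell₁ q) (S.cell₁ (p ≫ q))
  id₂ : letI := S.bicategory
    ∀ {f f' : Hom A A'} (p : f ⟶ f') (g : A.G), (S.cell₂ (𝟙 p)).k g = 1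
  vcomp : letI := S.bicategory
    ∀ {f f' : Hom A A'} {p q r : f ⟶ f'} (η : p ⟶ q) (θ : q ⟶ r) (g : A.G),
      (S.cell₂ (η ≫ θ)).k g = (S.cell₂ η).k g * (S.cell₂ θ).k g
  whiskerRight : letI := S.bicategory
    ∀ {f f' f'' : Hom A A'} {p q : f ⟶ f'} (η : p ⟶ q) (r : f' ⟶ f'') (i : ι),
      (S.cell₂ (η ▷ r)).k (b i) = A'.sec ((S.cell₁ r).s (b i))⁻¹ ((S.cell₂ η).k (b i))
  whiskerLeft : letI := S.bicategory
    ∀ {f'' f f' : Hom A A'} (r : f'' ⟶ f) {p q : f ⟶ f'} (η : p ⟶ q) (i : ι),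
      (S.cell₂ (r ◁ η)).k (b i) = (S.cell₂ η).k (b i)

/-- The explicit operations of the 2-groupoid `HOM_LAX(A, A')`. -/
structure IsHOMLax (T : TwoGroupoidOn (Hom A A') LaxHtpy (fun _ _ => LaxHtpy₂)) : Prop where
  id₁ : letI := T.bicategory
    ∀ f : Hom A A', (∀ g, (T.cell₁ (𝟙 f)).s g = 1) ∧ (∀ e, (T.cell₁ (𝟙 f)).t e = 1) ∧
      ∀ g h, (T.cell₁ (𝟙 f)).P g h = 1
  comp₁ : letI := T.bicategory
    ∀ {f f' f'' : Hom A A'} (p : f ⟶ f') (q : f' ⟶ f''),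
      (∀ g, (T.cell₁ (p ≫ q)).s g = (T.cell₁ p).s g * (T.cell₁ q).s g) ∧
      (∀ e, (T.cell₁ (p ≫ q)).t e =
        A'.sec ((T.cell₁ q).s (A.bd e))⁻¹ ((T.cell₁ p).t e) * (T.cell₁ q).t e) ∧
      ∀ g h, (T.cell₁ (p ≫ q)).P g h =
        Theta f.φ f'.φ (T.cell₁ p).s (T.cell₁ q).s (g * h) g h *
          (T.cell₁ q).P g h * (T.cell₁ p).P g h
  inv₁ : letI := T.bicategory
    ∀ {f f' : Hom A A'} (p : f ⟶ f') (q : f' ⟶ f), p ≫ q = 𝟙 f → q ≫ p = 𝟙 f' →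
      (∀ g, (T.cell₁ q).s g = ((T.cell₁ p).s g)⁻¹) ∧
      (∀ e, (T.cell₁ q).t e = A'.sec ((T.cell₁ p).s (A.bd e)) ((T.cell₁ p).t e)⁻¹) ∧
      ∀ g h, (T.cell₁ q).P g h =
        (Theta f.φ f'.φ (T.cell₁ p).s (fun a => ((T.cell₁ p).s a)⁻¹) (g * h) g h)⁻¹ *
          ((T.cell₁ p).P g h)⁻¹
  id₂ : letI := T.bicategory
    ∀ {f f' : Hom A A'} (p : f ⟶ f') (g : A.G), (T.cell₂ (𝟙 p)).k g = 1
  vcomp : letI := T.bicategory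
    ∀ {f f' : Hom A A'} {p q r : f ⟶ f'} (η : p ⟶ q) (θ : q ⟶ r) (g : A.G),
      (T.cell₂ (η ≫ θ)).k g = (T.cell₂ η).k g * (T.cell₂ θ).k g
  whiskerRight : letI := T.bicategory
    ∀ {f f' f'' : Hom A A'} {p q : f ⟶ f'} (η : p ⟶ q) (r : f' ⟶ f'') (g : A.G),
      (T.cell₂ (η ▷ r)).k g = A'.sec ((T.cell₁ r).s g)⁻¹ ((T.cell₂ η).k g)
  whiskerLeft : letI := T.bicategory
    ∀ {f'' f f' : Hom A A'} (r : f'' ⟶ f) {p q : f ⟶ f'} (η : p ⟶ q) (g : A.G),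
      (T.cell₂ (r ◁ η)).k g = (T.cell₂ η).k g

/-- `T` is the full sub-2-groupoid of `S` on the strict maps, a map `f : A → A'` being identified
with `f ∘ proj : Q¹(A) → A'`: there is a strict 2-functor `T → S`, given by `f ↦ f ∘ proj` on
objects, injective on objects and bijective on 1- and 2-morphisms, under which
`s([g]) = ŝ(g)`, `t(e, [∂e]) = t̂(e)`, `t(1, [gh]⁻¹[g][h]) = Π(g, h)` and `k([g]) = k̂(g)`. -/
def IsFullOnStrictMaps (T : TwoGroupoidOn (Hom A A') LaxHtpy (fun _ _ => LaxHtpy₂))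
    (S : TwoGroupoidOn (Hom A.Q1 A') Htpy (fun _ _ => Htpy₂)) : Prop :=
  letI := T.bicategory
  letI := S.bicategory
  ∃ F : StrictPseudofunctor (Hom A A') (Hom A.Q1 A'),
    (∀ f, F.obj f = f.comp A.proj) ∧
    Function.Injective F.obj ∧
    (∀ f f' : Hom A A', Function.Bijective (fun p : f ⟶ f' => F.map p)) ∧
    (∀ (f f' : Hom A A') (p q : f ⟶ f'), Function.Bijective (fun η : p ⟶ q => F.map₂ η)) ∧
    (∀ (f f' : Hom A A') (p : f ⟶ f'),
      (∀ g, (S.cell₁ (F.map p)).s (A.Q1basis g) = (T.cell₁ p).s g) ∧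
      (∀ e, (S.cell₁ (F.map p)).t (A.genE e) = (T.cell₁ p).t e) ∧
      ∀ g h, (S.cell₁ (F.map p)).t (A.genK g h) = (T.cell₁ p).P g h) ∧
    ∀ (f f' : Hom A A') (p q : f ⟶ f') (η : p ⟶ q) (g : A.G),
      (S.cell₂ (F.map₂ η)).k (A.Q1basis g) = (T.cell₂ η).k g

end Specification

end TwoCrossedModule

namespace TwoCrossedModule

/-! ### Calculus in a 2-crossed module -/

section Calculus

variable {A : TwoCrossedModule.{u}}

/-! The argument treats `(s, t, P)` as twisted non-abelian cocycle data. In place of axiom 3 and of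
the Θ-formula two equivalent forms are used. Applying the injective map `lact φ s g` to axiom 3
turns it into `TSmul` (`tSmul_iff`). The third component of a concatenation, Θ·P'·P, equals `compP`
(`compP_eq_theta`), where P and P' are inserted directly into a product of liftings.

Concatenation is controlled by four equivalences, the `comp_iff` lemmas. If the first factor
satisfies its axioms, then the concatenation satisfies an axiom if and only if the second factor
does. One direction makes concatenation well defined. The other gives inverses: the candidate
inverse is chosen so that the concatenation is the identity, which satisfies every axiom. All of
them rest on one commutation rule, `sec_bd_smul_sec`.

The functions `k : G → L'` form a group acting on the right on lax homotopies by `change`, and a lax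
2-fold homotopy from p to q is exactly a k with `q = p.change k`. The action commutes with
concatenation in the right factor, and up to twisting k in the left factor (`comp_change`,
`change_comp`). Every axiom about 2-morphisms is thereby an identity between labels in a group,
verified once in `LabelledCells`.

When G is free, a lax homotopy is a cocycle describing an extension of G by L', and the extension
splits. Hence exactly one k that is trivial on the basis changes P to 1 (`exists_trivialises`,
`Trivialises.unique`). Strict homotopies are thus normal forms of lax ones modulo changes that are
trivial on the basis. Their 2-groupoid is obtained by composing laxly and then strictifying, and the
splitting also supplies the morphism X into the triangle group.

The comparison functor precomposes with `proj` and strictifies. It is bijective on 1-morphisms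
because a strict homotopy over Q¹(A), changed by `Htpy.descender`, is constant on the fibres of
`proj` and so descends to A. It is bijective on 2-morphisms because a change between two precomposed
lax homotopies is itself constant on those fibres (`LaxHtpy.change_descends`). -/

theorem pl_one_right (e : A.E) : A.pl e 1 = 1 := by
  have h := A.pl_mul_right e 1 1
  have hδ : A.δ (A.pl e 1) = 1 := by rw [A.δ_pl]; simp
  have h1 : A.pl 1 1 = 1 := by simpa using A.pl_mul_left 1 1 1
  rw [hδ] at h
  simpa [h1] using h

theorem pl_one_left (e : A.E) : A.pl 1 e = 1 := by
  simpa using A.pl_mul_left 1 1 e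

theorem sec_one_left (l : A.L) : A.sec 1 l = l := by
  simp [sec, pl_one_right]

theorem sec_one_right (e : A.E) : A.sec e 1 = 1 := by
  simp [sec, pl_one_left]

theorem pl_mul_right' (e f g : A.E) :
    A.pl e (f * g) = A.pl e f * A.sec (A.bd e • f) (A.pl e g) := by
  rw [A.pl_mul_right]; simp [sec]

theorem sec_δ (l m : A.L) : A.sec (A.δ l) m = l * m * l⁻¹ := by
  rw [sec, ← map_inv, A.pl_δ_δ]; group

theorem pl_δ_left (l : A.L) (e : A.E) : A.pl (A.δ l) e = l * A.sec e l⁻¹ := by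
  simp [sec]

theorem pl_δ_right_mul (e : A.E) (l m : A.L) :
    A.pl e (A.δ (l * m)) * A.bd e • (l * m) =
      (A.pl e (A.δ l) * A.bd e • l) * (A.pl e (A.δ m) * A.bd e • m) := by
  rw [map_mul, pl_mul_right', ← A.δ_smul, sec_δ]
  simp only [smul_mul']
  group

/-- The map `l ↦ {e, δ l} · ∂e ▷ l` as a homomorphism. -/
def plδHom (e : A.E) : A.L →* A.L where
  toFun l := A.pl e (A.δ l) * A.bd e • l
  map_one' := by simp [pl_one_right]
  map_mul' := pl_δ_right_mul e

/-- The axiom on {δl, e}{e, δl} says that `sec e l` is inverse to `plδHom e l⁻¹`. Since `plδHom e`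
is a homomorphism, the two maps agree, and so ▷' acts by homomorphisms. -/
theorem sec_eq (e : A.E) (l : A.L) : A.sec e l = A.pl e (A.δ l) * A.bd e • l := by
  have h := A.pl_δ_mul_pl_δ e l⁻¹
  have h2 : plδHom e l * plδHom e l⁻¹ = 1 := by rw [← map_mul]; simp
  have h3 : A.sec e l = (plδHom e l⁻¹)⁻¹ := by
    rw [eq_inv_iff_mul_eq_one]
    simp only [plδHom, MonoidHom.coe_mk, OneHom.coe_mk, sec]
    rw [mul_assoc l, ← mul_assoc (A.pl _ _), ← map_inv, h]
    simp
  rw [h3]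
  exact (eq_inv_of_mul_eq_one_left h2).symm

theorem sec_mul (e : A.E) (l m : A.L) : A.sec e (l * m) = A.sec e l * A.sec e m := by
  simpa only [← sec_eq] using pl_δ_right_mul e l m

/-- The secondary action of an element as an endomorphism of `L`. -/
def secHom (e : A.E) : A.L →* A.L where
  toFun := A.sec e
  map_one' := sec_one_right e
  map_mul' := sec_mul e

theorem sec_inv (e : A.E) (l : A.L) : A.sec e l⁻¹ = (A.sec e l)⁻¹ := map_inv (secHom e) l

theorem mul_sec (e f : A.E) (l : A.L) : A.sec (e * f) l = A.sec e (A.sec f l) := by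
  have h : A.sec (e * f) l = A.sec e l * A.sec e (A.pl (A.δ l)⁻¹ f) := by
    conv_lhs => rw [sec, pl_mul_right']
    rw [← map_inv, A.bd_δ, one_smul, map_inv, ← mul_assoc]
    rfl
  rw [h, ← sec_mul]; rfl

theorem smul_sec (g : A.G) (e : A.E) (l : A.L) : g • A.sec e l = A.sec (g • e) (g • l) := by
  simp [sec, A.smul_pl, A.δ_smul]

theorem δ_sec (e : A.E) (l : A.L) : A.δ (A.sec e l) = e * A.δ l * e⁻¹ := by
  rw [sec, map_mul, A.δ_pl, ← map_inv, A.bd_δ, one_smul]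
  simp [mul_assoc]

theorem sec_inv_sec (e : A.E) (l : A.L) : A.sec e⁻¹ (A.sec e l) = l := by
  rw [← mul_sec]; simp [sec_one_left]

theorem sec_sec_inv (e : A.E) (l : A.L) : A.sec e (A.sec e⁻¹ l) = l := by
  rw [← mul_sec]; simp [sec_one_left]

theorem δ_mul_sec (l m : A.L) (e : A.E) : A.sec (A.δ l * e) m = l * A.sec e m * l⁻¹ := by
  rw [mul_sec, sec_δ]

theorem pl_δ_right (e : A.E) (l : A.L) : A.pl e (A.δ l) = A.sec e l * (A.bd e • l)⁻¹ := by
  rw [sec_eq]; group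

theorem pl_δ_mul_right (e f : A.E) (l : A.L) :
    A.pl e (A.δ l * f) = A.sec e l * A.pl e f * (A.bd e • l)⁻¹ := by
  rw [pl_mul_right', pl_δ_right, ← A.δ_smul, sec_δ]; group

theorem pl_δ_mul_left (e f : A.E) (l : A.L) :
    A.pl (A.δ l * e) f = l * A.sec (e * f * e⁻¹) l⁻¹ * A.pl e f := by
  rw [A.pl_mul_left, A.bd_δ, one_smul, pl_δ_left]

/-- Conjugation by a Peiffer lifting. -/
theorem pl_mul_sec (e f : A.E) (l : A.L) :
    A.pl e f * A.sec (A.bd e • f) l = A.sec (e * f * e⁻¹) l * A.pl e f := by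
  have h : A.sec (e * f * e⁻¹) l = A.sec (A.δ (A.pl e f) * (A.bd e • f)) l := by
    rw [A.δ_pl]; simp
  rw [h, δ_mul_sec]; group

theorem pl_δ_mul_left' (e f : A.E) (l : A.L) :
    A.pl (A.δ l * e) f = l * A.pl e f * A.sec (A.bd e • f) l⁻¹ := by
  rw [pl_δ_mul_left, mul_assoc l, ← pl_mul_sec, mul_assoc]

/-- Comes from expanding {e⁻¹e, f} = 1. It translates between the strict axioms, which use {ψ(b),
·}, and the lax ones, which use {ψ(b)⁻¹, ·}. -/
theorem sec_inv_pl (e f : A.E) : A.sec e⁻¹ (A.pl e f) = (A.pl e⁻¹ (A.bd e • f))⁻¹ := by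
  have h := A.pl_mul_left e⁻¹ e f
  have h2 : e * f * e⁻¹ = A.δ (A.pl e f) * (A.bd e • f) := by rw [A.δ_pl]; simp
  rw [inv_mul_cancel, pl_one_left, h2, pl_δ_mul_right] at h
  rw [eq_inv_iff_mul_eq_one, h]
  simp

theorem pl_inv_right (e f : A.E) : A.pl e f⁻¹ = (A.sec (A.bd e • f⁻¹) (A.pl e f))⁻¹ := by
  have h := pl_mul_right' e f⁻¹ f
  rw [inv_mul_cancel, pl_one_right] at h
  rw [eq_inv_iff_mul_eq_one, ← h]

/-- Conjugation by an element of `E`, in terms of the action of its boundary. -/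
theorem conj_eq (e f : A.E) : e * f * e⁻¹ = A.δ (A.pl e f) * (A.bd e • f) := by
  rw [A.δ_pl]; simp

theorem pl_mul_left' (e f g : A.E) :
    A.pl (e * f) g = A.sec e (A.pl f g) * A.pl e (A.bd f • g) := by
  rw [A.pl_mul_left, conj_eq, pl_δ_mul_right]; group

/-- Since efe⁻¹ = δ{e,f}·(∂e ▷ f), and δ of an element acts by conjugation, moving the action of e
past that of f costs conjugation by {e,f}. This is the only non-formal move in the identities below.
-/
theorem sec_bd_smul_sec (e f : A.E) (l : A.L) :
    A.sec (A.bd e • f) (A.sec e l) = (A.pl e f)⁻¹ * A.sec e (A.sec f l) * A.pl e f := by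
  have h := pl_mul_sec e f (A.sec e l)
  rw [mul_sec, sec_inv_sec, mul_sec] at h
  rw [mul_assoc, ← h]; group

end Calculus

/-! ### Identities in L for concatenating and changing homotopies -/

section Identities

variable {A : TwoCrossedModule.{u}}

/-- With u = s(g), S = s(∂a), ψ = ψ(a), this is the left side of axiom 3 without φ(g). The outer
`sec u` it exposes is what `lact φ s g` cancels. -/
theorem sec_pl_mul_eq (S u ψ : A.E) (t : A.L) :
    A.sec (u * S⁻¹) (A.pl ψ⁻¹ u⁻¹)⁻¹ * A.pl u (S⁻¹ * ψ⁻¹) * A.bd u • t =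
      A.sec u (A.sec S⁻¹ (A.pl ψ⁻¹ u⁻¹)⁻¹ * t *
        (A.pl u⁻¹ (A.bd u • (ψ * S * A.δ t)⁻¹))⁻¹) := by
  have h : (ψ * S * A.δ t)⁻¹ = A.δ t⁻¹ * (S⁻¹ * ψ⁻¹) := by simp
  rw [← sec_inv_pl, sec_mul, sec_mul, sec_sec_inv, mul_sec, h, pl_δ_mul_right, sec_inv u t,
    smul_inv']
  group

/-- Core of `TMul.comp_iff`, with S = s(∂a), S' = s'(∂a), S₂ = s(∂b), f = ψ(b). The product
f·S₂·δ(tb) is then ψ'(b), so the last bracket belongs to the axiom for the second factor. -/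
theorem t_mul_comp_identity (S S' S₂ f : A.E) (ta ta' tb : A.L) :
    A.pl S₂⁻¹ ((A.bd f)⁻¹ • S'⁻¹) *
      A.sec ((A.bd (f * S₂))⁻¹ • S'⁻¹)
        (A.sec S₂⁻¹ ((A.pl f⁻¹ S⁻¹)⁻¹ * A.sec f⁻¹ ta) * tb) *
      ((A.pl (f * S₂ * A.δ tb)⁻¹ S'⁻¹)⁻¹ * A.sec (f * S₂ * A.δ tb)⁻¹ ta') =
    A.sec S₂⁻¹ ((A.pl f⁻¹ (S * S')⁻¹)⁻¹ * A.sec f⁻¹ (A.sec S'⁻¹ ta * ta')) * tb := by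
  have hf : (f * S₂ * A.δ tb)⁻¹ = A.δ tb⁻¹ * (S₂⁻¹ * f⁻¹) := by simp
  have hu : (A.bd (f * S₂))⁻¹ = A.bd (S₂⁻¹ * f⁻¹) := by simp
  have e1 := sec_bd_smul_sec (S₂⁻¹ * f⁻¹) S'⁻¹ ta
  have e2 := sec_bd_smul_sec S₂⁻¹ (A.bd f⁻¹ • S'⁻¹) (A.pl f⁻¹ S⁻¹)
  rw [← mul_smul, ← map_mul] at e2
  simp only [hf, hu, mul_inv_rev, pl_δ_mul_left', pl_mul_right', δ_mul_sec, ← map_inv A.bd f,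
    sec_mul, sec_inv, e1, e2, ← mul_sec]
  rw [pl_mul_left' S₂⁻¹ f⁻¹ S'⁻¹]
  group

theorem pl_inv_mul_inv_eq (u u' q r : A.E) :
    A.sec (r⁻¹ * u'⁻¹ * q) (A.pl u⁻¹ (A.bd u • q⁻¹))⁻¹ * (A.pl u'⁻¹ (A.bd u' • r⁻¹))⁻¹ *
      A.sec u'⁻¹ (A.pl u⁻¹ (A.bd (u * u') • r⁻¹ * A.bd u • q))⁻¹ =
    (A.pl (u * u')⁻¹ (A.bd (u * u') • r⁻¹))⁻¹ := by
  have hr2 : A.bd u⁻¹ • A.bd (u * u') • r⁻¹ = A.bd u' • r⁻¹ := by simp [mul_smul]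
  have hq : A.pl u⁻¹ (A.bd u • q) = (A.sec q (A.pl u⁻¹ (A.bd u • q⁻¹)))⁻¹ := by
    have := pl_inv_right u⁻¹ (A.bd u • q⁻¹)
    simpa using this
  have e := sec_bd_smul_sec u'⁻¹ (A.bd u' • r⁻¹) (A.sec q (A.pl u⁻¹ (A.bd u • q⁻¹)))
  have hr : A.bd u'⁻¹ • A.bd u' • r⁻¹ = r⁻¹ := by simp
  rw [hr] at e
  rw [pl_mul_right', hr2, hq, mul_inv_rev u u', pl_mul_left', hr2]
  simp only [sec_mul, sec_inv, mul_sec, e]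
  group

/-- Core of `TSmul.comp_iff`, with u = s(g), u' = s'(g), S = s(∂a), S' = s'(∂a), ψ = ψ(a). The
longer products are ψ'(a) and ψ''(a). -/
theorem t_smul_comp_identity (S S' u u' ψ : A.E) (t t' : A.L) :
    A.sec S'⁻¹ (A.pl S⁻¹ ((A.bd ψ)⁻¹ • u'⁻¹)) *
      A.sec (S'⁻¹ * ((A.bd (ψ * S))⁻¹ • u'⁻¹))
        (A.sec S⁻¹ (A.pl ψ⁻¹ u⁻¹)⁻¹ * t * (A.pl u⁻¹ (A.bd u • (ψ * S * A.δ t)⁻¹))⁻¹) *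
      (A.sec S'⁻¹ (A.pl (ψ * S * A.δ t)⁻¹ u'⁻¹)⁻¹ * t' *
        (A.pl u'⁻¹ (A.bd u' • (ψ * S * A.δ t * S' * A.δ t')⁻¹))⁻¹) *
      A.sec u'⁻¹ (A.pl u⁻¹ (A.bd (u * u') • (ψ * S * A.δ t * S' * A.δ t')⁻¹ *
        A.bd u • (ψ * S * A.δ t)))⁻¹ =
    A.sec (S * S')⁻¹ (A.pl ψ⁻¹ (u * u')⁻¹)⁻¹ * (A.sec S'⁻¹ t * t') *
      (A.pl (u * u')⁻¹ (A.bd (u * u') • (ψ * S * A.δ t * S' * A.δ t')⁻¹))⁻¹ := by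
  rw [← pl_inv_mul_inv_eq u u' (ψ * S * A.δ t)]
  have hq : (ψ * S * A.δ t)⁻¹ = A.δ t⁻¹ * (S⁻¹ * ψ⁻¹) := by simp
  have hb : (A.bd (ψ * S))⁻¹ = A.bd (S⁻¹ * ψ⁻¹) := by simp
  generalize A.pl u⁻¹ (A.bd u • (ψ * S * A.δ t)⁻¹) = Z
  -- The argument is pulled back along S⁻¹ψ⁻¹ so that the commutation rule applies to tZ⁻¹t⁻¹
  -- itself.
  have e1 := sec_bd_smul_sec (S⁻¹ * ψ⁻¹) u'⁻¹ (A.sec (S⁻¹ * ψ⁻¹)⁻¹ (t * Z⁻¹ * t⁻¹))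
  rw [sec_sec_inv] at e1
  have e2 := sec_bd_smul_sec S⁻¹ (A.bd ψ⁻¹ • u'⁻¹) (A.pl ψ⁻¹ u⁻¹)
  rw [← mul_smul, ← map_mul] at e2
  have e4 : A.sec ((ψ * S * A.δ t * S' * A.δ t')⁻¹ * u'⁻¹ * (ψ * S * A.δ t)) Z⁻¹ =
      t'⁻¹ * A.sec S'⁻¹ (t⁻¹ * A.sec (S⁻¹ * ψ⁻¹) (A.sec u'⁻¹ (A.sec (S⁻¹ * ψ⁻¹)⁻¹
        (t * Z⁻¹ * t⁻¹))) * t) * t' := by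
    have h : (ψ * S * A.δ t * S' * A.δ t')⁻¹ * u'⁻¹ * (ψ * S * A.δ t) =
        A.δ t'⁻¹ * (S'⁻¹ * (A.δ t⁻¹ * ((S⁻¹ * ψ⁻¹) * (u'⁻¹ * ((S⁻¹ * ψ⁻¹)⁻¹ * A.δ t))))) := by
      simp [mul_assoc]
    rw [h, δ_mul_sec, mul_sec, δ_mul_sec, mul_sec (S⁻¹ * ψ⁻¹), mul_sec u'⁻¹, mul_sec (S⁻¹ * ψ⁻¹)⁻¹,
      sec_δ, inv_inv, inv_inv]
  have e5 : A.sec S⁻¹ (A.pl ψ⁻¹ u⁻¹)⁻¹ * t * Z⁻¹ =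
      A.sec S⁻¹ (A.pl ψ⁻¹ u⁻¹)⁻¹ * (t * Z⁻¹ * t⁻¹) * t := by group
  rw [e4, hb, hq, e5, mul_sec, sec_mul (A.bd _ • _), sec_mul (A.bd _ • _), e1, sec_inv S⁻¹, sec_inv (A.bd _ • _), e2,
    pl_δ_mul_left', mul_inv_rev u u', pl_mul_right' ψ⁻¹, mul_inv_rev S S', mul_sec S'⁻¹ S⁻¹, ← map_inv A.bd ψ]
  rw [pl_mul_left' S⁻¹ ψ⁻¹]
  simp only [sec_mul, sec_inv]
  group

theorem sec_pl_mul_pl_eq (e a m u : A.E) :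
    A.sec e (A.sec a (A.pl m u)) * A.pl e (a * A.bd m • u) =
      A.pl e a * A.sec (A.bd e • a) (A.pl (e * m) u) := by
  rw [pl_mul_left', pl_mul_right', sec_mul, sec_bd_smul_sec]
  group

theorem t_mul_change_identity (S S₂ f : A.E) (ta tb m m₂ : A.L) :
    m₂⁻¹ * (A.sec S₂⁻¹ ((A.bd f)⁻¹ • m))⁻¹ *
      (A.sec S₂⁻¹ ((A.pl f⁻¹ S⁻¹)⁻¹ * A.sec f⁻¹ ta) * tb) =
    A.sec (S₂ * A.δ m₂)⁻¹ ((A.pl f⁻¹ (S * A.δ m)⁻¹)⁻¹ * A.sec f⁻¹ (m⁻¹ * ta)) *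
      (m₂⁻¹ * tb) := by
  rw [mul_inv_rev S₂, mul_inv_rev S, ← map_inv A.δ, ← map_inv A.δ, δ_mul_sec, pl_δ_mul_right,
    map_inv A.bd]
  simp only [sec_mul, sec_inv, smul_inv']
  group

/-- Here m = k(g) and n = k(∂a). The change leaves ψ(a)s(∂a)δt(a) fixed, because δn cancels against
δn⁻¹. Only the lifting and conjugation terms move. -/
theorem t_smul_change_identity (S u ψ : A.E) (t m n : A.L) :
    n⁻¹ * (A.sec S⁻¹ ((A.bd ψ)⁻¹ • m))⁻¹ *
      (A.sec S⁻¹ (A.pl ψ⁻¹ u⁻¹)⁻¹ * t * (A.pl u⁻¹ (A.bd u • (ψ * S * A.δ t)⁻¹))⁻¹) * m =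
    A.sec (S * A.δ n)⁻¹ (A.pl ψ⁻¹ (u * A.δ m)⁻¹)⁻¹ * (n⁻¹ * t) *
      (A.pl (u * A.δ m)⁻¹
        (A.bd (u * A.δ m) • (ψ * (S * A.δ n) * A.δ (n⁻¹ * t))⁻¹))⁻¹ := by
  have hq : ψ * (S * A.δ n) * A.δ (n⁻¹ * t) = ψ * S * A.δ t := by simp [mul_assoc]
  have hr : A.bd u⁻¹ • A.bd u • (ψ * S * A.δ t)⁻¹ = (ψ * S * A.δ t)⁻¹ := by simp
  have hb : A.bd (u * A.δ m) = A.bd u := by simp [A.bd_δ]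
  have h1 : (ψ * S * A.δ t)⁻¹ = A.δ t⁻¹ * (S⁻¹ * ψ⁻¹) := by simp
  have e1 : A.sec (ψ * S * A.δ t)⁻¹ m = t⁻¹ * A.sec S⁻¹ (A.sec ψ⁻¹ m) * t := by
    rw [h1, δ_mul_sec, mul_sec, inv_inv]
  rw [hq, hb, mul_inv_rev u, mul_inv_rev S, ← map_inv A.δ m, ← map_inv A.δ n, δ_mul_sec,
    pl_δ_mul_right, pl_δ_mul_left', hr, inv_inv m, e1, map_inv A.bd]
  simp only [sec_mul, sec_inv, smul_inv']
  group

end Identities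

/-! ### Lax derivations -/

section LaxDerivation

variable {A : TwoCrossedModule.{u}} {A' : TwoCrossedModule.{v}}

/-- The automorphism `l ↦ s(h)⁻¹ ▷' (φ(h)⁻¹ ▷ l)` of `L'`. -/
def lact (φ : A.G →* A'.G) (s : A.G → A'.E) (h : A.G) : A'.L →* A'.L :=
  (secHom (s h)⁻¹).comp (MulDistribMulAction.toMonoidHom A'.L (φ h)⁻¹)

theorem lact_apply (φ : A.G →* A'.G) (s : A.G → A'.E) (h : A.G) (l : A'.L) :
    lact φ s h l = A'.sec (s h)⁻¹ ((φ h)⁻¹ • l) := rfl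

theorem smul_sec_lact (φ : A.G →* A'.G) (s : A.G → A'.E) (h : A.G) (l : A'.L) :
    φ h • A'.sec (s h) (lact φ s h l) = l := by
  rw [lact_apply, sec_sec_inv, smul_inv_smul]

theorem lact_smul_sec (φ : A.G →* A'.G) (s : A.G → A'.E) (h : A.G) (l : A'.L) :
    lact φ s h (φ h • A'.sec (s h) l) = l := by
  rw [lact_apply, inv_smul_smul, sec_inv_sec]

theorem lact_injective (φ : A.G →* A'.G) (s : A.G → A'.E) (h : A.G) :
    Function.Injective (lact φ s h) :=
  Function.LeftInverse.injective (g := fun l => φ h • A'.sec (s h) l) (smul_sec_lact φ s h)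

/-- `s` is a derivation up to `δ P`. -/
def SMul (φ : A.G →* A'.G) (s : A.G → A'.E) (P : A.G → A.G → A'.L) : Prop :=
  ∀ g h, s (g * h) = ((φ h)⁻¹ • s g) * s h * A'.δ (P g h)

/-- `P` is a cocycle for the automorphisms `lact φ s`. -/
def IsCocycle (φ : A.G →* A'.G) (s : A.G → A'.E) (P : A.G → A.G → A'.L) : Prop :=
  ∀ g h i, lact φ s i (P g h) * P (g * h) i = P h i * P g (h * i)

/-- The compatibility of `t` with products. -/
def TMul (f : Hom A A') (s : A.G → A'.E) (t : A.E → A'.L) (P : A.G → A.G → A'.L) : Prop :=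
  ∀ a b, P (A.bd a) (A.bd b) * t (a * b) =
    A'.sec (s (A.bd b))⁻¹
      ((A'.pl (f.ψ b)⁻¹ (s (A.bd a))⁻¹)⁻¹ * A'.sec (f.ψ b)⁻¹ (t a)) * t b

/-- The compatibility of `t` with the action. -/
def TSmul (f : Hom A A') (s : A.G → A'.E) (t : A.E → A'.L) (P : A.G → A.G → A'.L) : Prop :=
  ∀ (g : A.G) (a : A.E),
    P g (A.bd a) * (P (g * A.bd a * g⁻¹) g)⁻¹ * lact f.φ s g (t (g • a)) =
      A'.sec (s (A.bd a))⁻¹ (A'.pl (f.ψ a)⁻¹ (s g)⁻¹)⁻¹ * t a *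
        (A'.pl (s g)⁻¹ (A'.bd (s g) • (f.ψ a * s (A.bd a) * A'.δ (t a))⁻¹))⁻¹

variable {φ : A.G →* A'.G} {s : A.G → A'.E} {P : A.G → A.G → A'.L}

/-- The failure of s to be a derivation is δP, which acts by conjugation. So the automorphisms
`lact` form an action up to conjugation by P. -/
theorem SMul.lact_mul (h : SMul φ s P) (g i : A.G) (l : A'.L) :
    lact φ s (g * i) l = (P g i)⁻¹ * lact φ s i (lact φ s g l) * P g i := by
  rw [lact_apply, h g i, mul_inv_rev, ← map_inv, δ_mul_sec, lact_apply, lact_apply, smul_sec,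
    map_mul, mul_inv_rev, mul_inv_rev, mul_sec, mul_smul, inv_inv, smul_inv']

theorem SMul.s_one (h : SMul φ s P) : s 1 = (A'.δ (P 1 1))⁻¹ := by
  have := h 1 1
  simp only [map_one, inv_one, one_smul, mul_one] at this
  rw [mul_assoc, left_eq_mul] at this
  exact eq_inv_of_mul_eq_one_left this

theorem SMul.lact_one (h : SMul φ s P) (l : A'.L) :
    lact φ s 1 l = P 1 1 * l * (P 1 1)⁻¹ := by
  rw [lact_apply, h.s_one, inv_inv, sec_δ]; simp

theorem IsCocycle.right_one (h : SMul φ s P) (hP : IsCocycle φ s P) (g : A.G) :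
    P g 1 = P 1 1 := by
  have := hP g 1 1
  simp only [mul_one, h.lact_one] at this
  have h2 := mul_right_cancel this
  rw [mul_inv_eq_iff_eq_mul, mul_right_inj] at h2
  exact h2

/-- Explains the four-term prefix in axiom 3. After applying `lact` at g⁻¹, the right side is the
quotient of the cocycle identities at (g, x, g⁻¹) and (gxg⁻¹, g, g⁻¹). -/
theorem IsCocycle.lact_prefix (h : SMul φ s P) (hP : IsCocycle φ s P) (g x : A.G) :
    lact φ s g ((P 1 1)⁻¹ * (P g g⁻¹)⁻¹ * P x g⁻¹ * P g (x * g⁻¹)) =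
      P g x * (P (g * x * g⁻¹) g)⁻¹ := by
  apply lact_injective φ s g⁻¹
  have e1 := h.lact_mul g g⁻¹ ((P 1 1)⁻¹ * (P g g⁻¹)⁻¹ * P x g⁻¹ * P g (x * g⁻¹))
  rw [mul_inv_cancel, h.lact_one] at e1
  have e2 := hP g x g⁻¹
  have e3 := hP (g * x * g⁻¹) g g⁻¹
  rw [mul_inv_cancel, hP.right_one h, inv_mul_cancel_right] at e3
  rw [map_mul _ (P g x), map_inv, eq_mul_inv_of_mul_eq e2, eq_mul_inv_of_mul_eq e3]
  have e4 : ∀ (x y z w : A'.L), x = y⁻¹ * z * y → z = y * x * y⁻¹ := by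
    rintro x y z w rfl; group
  rw [e4 _ _ _ 1 e1]
  group

theorem tSmul_iff {f : Hom A A'} {t : A.E → A'.L} (h : SMul f.φ s P) (hP : IsCocycle f.φ s P) :
    TSmul f s t P ↔ ∀ (g : A.G) (a : A.E),
      (f.φ g • A'.sec (s g * (s (A.bd a))⁻¹) (A'.pl (f.ψ a)⁻¹ (s g)⁻¹)⁻¹) *
        (f.φ g • A'.pl (s g) ((s (A.bd a))⁻¹ * (f.ψ a)⁻¹)) *
        ((f.φ g * A'.bd (s g)) • t a) =
      (P 1 1)⁻¹ * (P g g⁻¹)⁻¹ * P (A.bd a) g⁻¹ * P g (A.bd a * g⁻¹) * t (g • a) := by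
  refine forall_congr' fun g => forall_congr' fun a => ?_
  rw [mul_smul, ← smul_mul', ← smul_mul', sec_pl_mul_eq, ← (lact_injective f.φ s g).eq_iff (a := f.φ g • _),
    lact_smul_sec, map_mul, hP.lact_prefix h]
  exact eq_comm

variable {f₁ f₂ : Hom A A'}

theorem LaxHtpy.sMul (p : LaxHtpy f₁ f₂) : SMul f₁.φ p.s p.P := p.s_mul

theorem LaxHtpy.isCocycle (p : LaxHtpy f₁ f₂) : IsCocycle f₁.φ p.s p.P := p.P_cocycle

theorem LaxHtpy.tMul (p : LaxHtpy f₁ f₂) : TMul f₁ p.s p.t p.P := p.t_mul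

theorem LaxHtpy.tSmul (p : LaxHtpy f₁ f₂) : TSmul f₁ p.s p.t p.P :=
  (tSmul_iff p.sMul p.isCocycle).2 p.t_smul

/-- A lax homotopy from the simplified axioms. -/
def LaxHtpy.mk' (s : A.G → A'.E) (t : A.E → A'.L) (P : A.G → A.G → A'.L) (h₁ : SMul f₁.φ s P)
    (h₂ : IsCocycle f₁.φ s P) (h₃ : TMul f₁ s t P) (h₄ : TSmul f₁ s t P)
    (hφ : ∀ g, f₂.φ g = f₁.φ g * A'.bd (s g))
    (hψ : ∀ e, f₂.ψ e = f₁.ψ e * s (A.bd e) * A'.δ (t e))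
    (hμ : ∀ l, f₂.μ l = f₁.μ l * (P 1 1)⁻¹ * t (A.δ l)) : LaxHtpy f₁ f₂ where
  s := s
  t := t
  P := P
  bd_s_mul g h := by rw [h₁ g h, map_mul _ _ (A'.δ _), A'.bd_δ, mul_one]
  s_mul := h₁
  t_mul := h₃
  t_smul := (tSmul_iff h₁ h₂).1 h₄
  P_cocycle := h₂
  φ_eq := hφ
  ψ_eq := hψ
  μ_eq := hμ

end LaxDerivation

/-! ### Separating the contributions of the two cocycles -/

section CompIdentities

variable {A : TwoCrossedModule.{u}}

/-- With e = s(j), e' = s'(j), and p, m the translates by φ(j)⁻¹ of P(g,i), P'(g,i), the term in m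
is moved to the far right, where it is `lact φ' s' j (P' g i)`. -/
theorem cocycle_comp_left (e e' y : A.E) (R p m p₂ : A.L) :
    A.sec (e * e')⁻¹ (R * A.sec y⁻¹ p * m) *
      (A.sec e'⁻¹ (A.pl e⁻¹ (y * A.δ m)⁻¹) *
        A.sec ((A.bd e)⁻¹ • (y * A.δ m) * e')⁻¹ p₂) =
    A.sec e'⁻¹ (A.sec e⁻¹ R * A.pl e⁻¹ y⁻¹ *
      A.sec ((A.bd e)⁻¹ • y⁻¹) (A.sec e⁻¹ p * p₂)) * A.sec e'⁻¹ ((A.bd e)⁻¹ • m) := by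
  have h : ((A.bd e)⁻¹ • (y * A.δ m) * e')⁻¹ =
      e'⁻¹ * (A.δ ((A.bd e)⁻¹ • m)⁻¹ * (A.bd e)⁻¹ • y⁻¹) := by
    simp [A.δ_smul, smul_mul', mul_assoc]
  have e1 := sec_bd_smul_sec e⁻¹ y⁻¹ p
  rw [map_inv] at e1
  rw [h, mul_inv_rev y, ← map_inv A.δ, pl_δ_mul_right, mul_sec e'⁻¹ (A.δ _ * _), δ_mul_sec,
    mul_inv_rev e, mul_sec e'⁻¹ e⁻¹, map_inv A.bd, sec_mul (_ • _), e1, smul_inv']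
  simp only [sec_mul, sec_inv]
  group

theorem cocycle_comp_right (v Y u : A.E) (R p p' p₂ : A.L) :
    R * A.sec Y⁻¹ p * p' * (A.sec (Y * A.δ p')⁻¹ (A.pl (v * A.δ p)⁻¹ u) *
        A.sec ((A.bd v)⁻¹ • u⁻¹ * (Y * A.δ p'))⁻¹ p₂) =
      R * A.sec Y⁻¹ (A.pl v⁻¹ u * A.sec ((A.bd v)⁻¹ • u) (p * p₂)) * p' := by
  have h : ((A.bd v)⁻¹ • u⁻¹ * (Y * A.δ p'))⁻¹ =
      A.δ p'⁻¹ * (Y⁻¹ * (A.bd v)⁻¹ • u) := by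
    simp [mul_assoc]
  rw [h, mul_inv_rev v, ← map_inv A.δ p, pl_δ_mul_left', mul_inv_rev Y, ← map_inv A.δ p',
    δ_mul_sec, δ_mul_sec, mul_sec, map_inv A.bd]
  simp only [sec_mul, sec_inv]
  group

/-- Y₁ and Y₂ come from the factorisations of g∂a as g·∂a and as (g∂a g⁻¹)·g. The hypothesis `h`
holds because both compute s'(g∂a). -/
theorem t_smul_comp_left (e e' v Y₁ Y₂ : A.E) (R p₁ p₁' p₂ p₂' T T' : A.L)
    (hY : Y₂ = (A.bd e)⁻¹ • v⁻¹ * e') (h : Y₁ * A.δ p₁' = Y₂ * A.δ p₂') :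
    R * A.sec Y₁⁻¹ p₁ * p₁' * (A.sec e'⁻¹ (A.pl e⁻¹ v) * A.sec Y₂⁻¹ p₂ * p₂')⁻¹ *
        A.sec (e * e')⁻¹ (A.sec v T * T') =
      R * A.sec Y₁⁻¹ (p₁ * p₂⁻¹ * A.sec e⁻¹ T) *
        (p₁' * p₂'⁻¹ * A.sec e'⁻¹ ((A.bd e)⁻¹ • T')) *
        A.sec e'⁻¹ (A.pl e⁻¹ (A.δ T'⁻¹ * v))⁻¹ := by
  have h1 : Y₁⁻¹ = A.δ (p₁' * p₂'⁻¹) * Y₂⁻¹ := by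
    rw [eq_mul_inv_of_mul_eq h]; simp [mul_assoc]
  have h2 : Y₂⁻¹ = e'⁻¹ * (A.bd e)⁻¹ • v := by rw [hY]; simp
  have e1 := sec_bd_smul_sec e⁻¹ v T
  rw [map_inv] at e1
  have e2 : A.sec Y₂⁻¹ (A.sec e⁻¹ T) = A.sec e'⁻¹ ((A.pl e⁻¹ v)⁻¹ *
      A.sec e⁻¹ (A.sec v T) * A.pl e⁻¹ v) := by
    rw [h2, mul_sec, e1]
  rw [h1, δ_mul_sec, δ_mul_sec, sec_mul Y₂⁻¹, e2, pl_δ_mul_right, mul_inv_rev e, mul_sec e'⁻¹ e⁻¹,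
    map_inv A.bd, smul_inv']
  simp only [sec_mul, sec_inv]
  group

end CompIdentities

/-! ### Concatenation of lax derivations -/

section Comp

variable {A : TwoCrossedModule.{u}} {A' : TwoCrossedModule.{v}}

/-- The second component of a concatenation. -/
def compT (s' : A.G → A'.E) (t t' : A.E → A'.L) (e : A.E) : A'.L :=
  A'.sec (s' (A.bd e))⁻¹ (t e) * t' e

/-- The third component of a concatenation. -/
def compP (φ φ' : A.G →* A'.G) (s s' : A.G → A'.E) (P P' : A.G → A.G → A'.L)
    (g h : A.G) : A'.L :=
  A'.sec (s' h)⁻¹ (A'.pl (s h)⁻¹ ((φ h)⁻¹ • (s' g)⁻¹)) *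
    A'.sec (((φ' h)⁻¹ • s' g) * s' h)⁻¹ (P g h) * P' g h

variable {φ φ' : A.G →* A'.G} {s s' : A.G → A'.E} {P P' : A.G → A.G → A'.L}

theorem inv_smul_eq (hφ : ∀ g, φ' g = φ g * A'.bd (s g)) {X : Type*} [MulAction A'.G X] (g : A.G) (x : X) :
    (φ' g)⁻¹ • x = (A'.bd (s g))⁻¹ • (φ g)⁻¹ • x := by
  rw [hφ, mul_inv_rev, mul_smul]

/-- Both sides for the concatenation are s(gi) times the sides for (s', P'). The equivalence is
needed in full: the forward direction proves the axioms of inverses. -/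
theorem SMul.comp_iff (hφ : ∀ g, φ' g = φ g * A'.bd (s g)) (h : SMul φ s P) :
    SMul φ (s * s') (compP φ φ' s s' P P') ↔ SMul φ' s' P' := by
  refine forall_congr' fun g => forall_congr' fun i => ?_
  rw [← mul_right_inj (s (g * i)) (b := s' (g * i))]
  have e : (φ i)⁻¹ • (s * s') g * (s * s') i * A'.δ (compP φ φ' s s' P P' g i) =
      s (g * i) * ((φ' i)⁻¹ • s' g * s' i * A'.δ (P' g i)) := by
    simp only [compP, map_mul, δ_sec, A'.δ_pl, h g i, Pi.mul_apply, smul_mul', inv_smul_eq hφ,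
      map_inv, smul_inv', inv_inv, mul_inv_rev]
    group
  rw [e]
  rfl

/-- Each side of the concatenated cocycle identity is a common factor C times the matching side for
P'. That C is the same on both sides is the cocycle identity of P, whose common value is Q. -/
theorem IsCocycle.comp_iff (hφ : ∀ g, φ' g = φ g * A'.bd (s g)) (h : SMul φ s P)
    (h' : SMul φ' s' P') (hP : IsCocycle φ s P) :
    IsCocycle φ (s * s') (compP φ φ' s s' P P') ↔ IsCocycle φ' s' P' := by
  refine forall_congr' fun g => forall_congr' fun i => forall_congr' fun j => ?_
  obtain ⟨K, hK⟩ : ∃ x, x = (φ j)⁻¹ • s' i := ⟨_, rfl⟩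
  obtain ⟨M, hM⟩ : ∃ x, x = (φ j)⁻¹ • s i := ⟨_, rfl⟩
  obtain ⟨U, hU⟩ : ∃ x, x = (φ (i * j))⁻¹ • (s' g)⁻¹ := ⟨_, rfl⟩
  obtain ⟨Q, hQ⟩ : ∃ x, x = P i j * P g (i * j) := ⟨_, rfl⟩
  obtain ⟨C, hC⟩ : ∃ x, x = A'.sec (s' j)⁻¹ (A'.pl (s j)⁻¹ K⁻¹) *
    A'.sec ((A'.bd (s j))⁻¹ • K * s' j)⁻¹ (A'.pl (M * s j)⁻¹ U *
      A'.sec ((A'.bd (M * s j))⁻¹ • U) Q) := ⟨_, rfl⟩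
  have hK' : (φ j)⁻¹ • (s' i)⁻¹ = K⁻¹ := by rw [hK, smul_inv']
  have hU' : (φ (i * j))⁻¹ • s' g = U⁻¹ := by rw [hU]; simp
  have hb : A'.bd (s (i * j)) = A'.bd (M * s j) := by
    rw [h, map_mul _ _ (A'.δ _), A'.bd_δ, mul_one, hM]
  have hMU : (φ j)⁻¹ • (φ' i)⁻¹ • s' g = A'.bd M⁻¹ • U⁻¹ := by
    rw [inv_smul_eq hφ, hM, map_inv, A'.bd_smul, hU, map_mul]
    simp only [smul_inv', inv_inv, mul_inv_rev, mul_smul, smul_inv_smul]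
  have e1 : lact φ (s * s') j (compP φ φ' s s' P P' g i) * compP φ φ' s s' P P' (g * i) j =
      C * (lact φ' s' j (P' g i) * P' (g * i) j) := by
    have hQ' : A'.sec (s j)⁻¹ ((φ j)⁻¹ • P g i) * P (g * i) j = Q := (hP g i j).trans hQ.symm
    have hy : (φ j)⁻¹ • ((φ' i)⁻¹ • s' g * s' i) = A'.bd M⁻¹ • U⁻¹ * K := by
      rw [smul_mul', hMU, hK]
    have := cocycle_comp_left (s j) (s' j) (A'.bd M⁻¹ • U⁻¹ * K) (A'.sec K⁻¹ (A'.pl M⁻¹ U))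
      ((φ j)⁻¹ • P g i) ((φ j)⁻¹ • P' g i) (P (g * i) j)
    have e3 : (φ j)⁻¹ • A'.sec (s' i)⁻¹ (A'.pl (s i)⁻¹ ((φ i)⁻¹ • (s' g)⁻¹)) =
        A'.sec K⁻¹ (A'.pl M⁻¹ U) := by
      rw [smul_sec, A'.smul_pl, hK', smul_inv', ← hM, ← mul_smul, ← mul_inv_rev, ← map_mul, hU]
    have e4 : (A'.bd M⁻¹ • U⁻¹ * K)⁻¹ = K⁻¹ * A'.bd M⁻¹ • U := by simp
    have e5 := sec_pl_mul_pl_eq (s j)⁻¹ K⁻¹ M⁻¹ U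
    have e6 : A'.bd (s j)⁻¹ • (K⁻¹ * A'.bd M⁻¹ • U) =
        A'.bd (s j)⁻¹ • K⁻¹ * A'.bd (M * s j)⁻¹ • U := by
      simp [mul_smul]
    have e7 : (φ j)⁻¹ • s' (g * i) = A'.bd M⁻¹ • U⁻¹ * K * A'.δ ((φ j)⁻¹ • P' g i) := by
      rw [h', smul_mul', hy, A'.δ_smul]
    have e8 : (φ j)⁻¹ • (s' (g * i))⁻¹ = (A'.bd M⁻¹ • U⁻¹ * K * A'.δ ((φ j)⁻¹ • P' g i))⁻¹ := by
      rw [smul_inv', e7]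
    simp only [compP, lact_apply, Pi.mul_apply, smul_mul']
    rw [e3, smul_sec, smul_inv', hy, inv_smul_eq hφ j (s' (g * i)), e7, e8, ← mul_assoc, this, hQ',
      e4, ← map_inv A'.bd (s j), e6, mul_sec _ (A'.bd _ • U), e5, hC]
    have e9 : ((A'.bd (s j))⁻¹ • K * s' j)⁻¹ = (s' j)⁻¹ * A'.bd (s j)⁻¹ • K⁻¹ := by simp
    have e10 : (A'.bd (M * s j))⁻¹ = A'.bd ((s j)⁻¹ * M⁻¹) := by simp
    rw [e9, e10, mul_inv_rev M, inv_smul_eq hφ, ← map_inv A'.bd (s j)]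
    simp only [sec_mul, mul_sec]
    group
  have e2 : compP φ φ' s s' P P' i j * compP φ φ' s s' P P' g (i * j) =
      C * (P' i j * P' g (i * j)) := by
    have := cocycle_comp_right (M * s j) ((A'.bd (s j))⁻¹ • K * s' j) U
      (A'.sec (s' j)⁻¹ (A'.pl (s j)⁻¹ K⁻¹)) (P i j) (P' i j) (P g (i * j))
    have e3 : (φ' (i * j))⁻¹ • s' g = (A'.bd (M * s j))⁻¹ • U⁻¹ := by
      rw [inv_smul_eq hφ, hb, hU]; simp
    have e4 : s' (i * j) = (A'.bd (s j))⁻¹ • K * s' j * A'.δ (P' i j) := by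
      rw [h' i j, inv_smul_eq hφ, hK]
    simp only [compP]
    rw [e3, inv_smul_eq hφ, ← mul_assoc, ← mul_assoc C, e4, h i j, ← hK, ← hM, ← hU, hK', this,
      hC, hQ]
  rw [e1, e2, mul_right_inj]

variable {f f' f'' : Hom A A'} {t t' : A.E → A'.L}

/-- Same scheme as for the cocycle identity: both sides carry a common left factor C, identified by
means of the axiom for (s, t, P), and cancelling it leaves the axiom for (s', t', P'). -/
theorem TMul.comp_iff (hψ : ∀ e, f'.ψ e = f.ψ e * s (A.bd e) * A'.δ (t e)) (h' : SMul f'.φ s' P')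
    (ht : TMul f s t P) :
    TMul f (s * s') (compT s' t t') (compP f.φ f'.φ s s' P P') ↔ TMul f' s' t' P' := by
  refine forall_congr' fun a => forall_congr' fun b => ?_
  have hid := t_mul_comp_identity (s (A.bd a)) (s' (A.bd a)) (s (A.bd b)) (f.ψ b)
    (t a) (t' a) (t b)
  rw [← hψ b, ← ht a b] at hid
  obtain ⟨C, hC⟩ : ∃ x, x = A'.sec (s' (A.bd b))⁻¹ (A'.pl (s (A.bd b))⁻¹
      ((A'.bd (f.ψ b))⁻¹ • (s' (A.bd a))⁻¹)) *
    A'.sec (s' (A.bd b))⁻¹ (A'.sec ((A'.bd (f.ψ b * s (A.bd b)))⁻¹ • (s' (A.bd a))⁻¹)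
      (P (A.bd a) (A.bd b) * t (a * b))) := ⟨_, rfl⟩
  have hb : f'.φ (A.bd b) = A'.bd (f.ψ b * s (A.bd b)) := by
    rw [f'.φ_bd, hψ, map_mul _ _ (A'.δ _), A'.bd_δ, mul_one]
  have e1 : compP f.φ f'.φ s s' P P' (A.bd a) (A.bd b) * compT s' t t' (a * b) =
      C * (P' (A.bd a) (A.bd b) * t' (a * b)) := by
    have hY : (A'.bd (f.ψ b * s (A.bd b)))⁻¹ • (s' (A.bd a))⁻¹ =
        ((A'.bd (f.ψ b * s (A.bd b)))⁻¹ • s' (A.bd a))⁻¹ := smul_inv' _ _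
    rw [compP, compT, map_mul A.bd, h', hC, mul_inv_rev _ (A'.δ _), ← map_inv A'.δ, δ_mul_sec, hb,
      f.φ_bd, hY, ← mul_sec, ← mul_inv_rev, sec_mul]
    group
  have e2 : A'.sec ((s * s') (A.bd b))⁻¹
      ((A'.pl (f.ψ b)⁻¹ ((s * s') (A.bd a))⁻¹)⁻¹ * A'.sec (f.ψ b)⁻¹ (compT s' t t' a)) *
        compT s' t t' b =
      C * (A'.sec (s' (A.bd b))⁻¹
      ((A'.pl (f'.ψ b)⁻¹ (s' (A.bd a))⁻¹)⁻¹ * A'.sec (f'.ψ b)⁻¹ (t' a)) * t' b) := by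
    rw [compT, compT, Pi.mul_apply, Pi.mul_apply, mul_inv_rev (s (A.bd b)),
      mul_sec (s' (A.bd b))⁻¹, ← mul_assoc, ← sec_mul, ← hid, hC]
    simp only [sec_mul, mul_assoc]
  rw [e1, e2, mul_right_inj]

theorem TSmul.comp_iff (hφ : ∀ g, f'.φ g = f.φ g * A'.bd (s g))
    (hψ : ∀ e, f'.ψ e = f.ψ e * s (A.bd e) * A'.δ (t e))
    (hφ' : ∀ g, f''.φ g = f'.φ g * A'.bd (s' g))
    (hψ' : ∀ e, f''.ψ e = f'.ψ e * s' (A.bd e) * A'.δ (t' e))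
    (h' : SMul f'.φ s' P') (ht : TSmul f s t P) :
    TSmul f (s * s') (compT s' t t') (compP f.φ f'.φ s s' P P') ↔ TSmul f' s' t' P' := by
  refine forall_congr' fun g => forall_congr' fun a => ?_
  have hid := t_smul_comp_identity (s (A.bd a)) (s' (A.bd a)) (s g) (s' g) (f.ψ a) (t a) (t' a)
  have hta := ht g a
  rw [← hψ a] at hid hta
  rw [← hψ' a] at hid ⊢
  rw [← hta] at hid
  have hx : g * A.bd a * g⁻¹ * g = g * A.bd a := by group
  have hl := t_smul_comp_left (s g) (s' g) ((f.φ g)⁻¹ • (s' (g * A.bd a * g⁻¹))⁻¹)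
    ((f'.φ (A.bd a))⁻¹ • s' g * s' (A.bd a)) ((f'.φ g)⁻¹ • s' (g * A.bd a * g⁻¹) * s' g)
    (A'.sec (s' (A.bd a))⁻¹ (A'.pl (s (A.bd a))⁻¹ ((f.φ (A.bd a))⁻¹ • (s' g)⁻¹)))
    (P g (A.bd a)) (P' g (A.bd a)) (P (g * A.bd a * g⁻¹) g) (P' (g * A.bd a * g⁻¹) g)
    ((f.φ g)⁻¹ • t (g • a)) ((f.φ g)⁻¹ • t' (g • a)) (by rw [inv_smul_eq hφ]; simp)
    (by rw [← h', ← h', hx])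
  -- The formula for ψ'' at g ▷ a, with equivariance of f' and f'', trades t'(g ▷ a) for the values
  -- at a.
  have hlast : A'.δ ((f.φ g)⁻¹ • t' (g • a))⁻¹ * (f.φ g)⁻¹ • (s' (g * A.bd a * g⁻¹))⁻¹ =
      A'.bd (s g * s' g) • (f''.ψ a)⁻¹ * A'.bd (s g) • f'.ψ a := by
    have h1 := hψ' (g • a)
    rw [f''.ψ_smul, f'.ψ_smul, A.bd_smul, hφ', hφ, mul_smul, mul_smul, mul_smul, mul_assoc,
      ← inv_mul_eq_iff_eq_mul] at h1
    rw [map_inv, A'.δ_smul, ← smul_inv', ← smul_mul', ← mul_inv_rev, ← h1]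
    simp [mul_smul]
  have hfa : f'.φ (A.bd a) = A'.bd (f.ψ a * s (A.bd a)) := by
    rw [f'.φ_bd, hψ, map_mul _ _ (A'.δ _), A'.bd_δ, mul_one]
  have hcomp : f.ψ a * (s * s') (A.bd a) * A'.δ (compT s' t t' a) = f''.ψ a := by
    rw [hψ', hψ, compT, map_mul, δ_sec, Pi.mul_apply]; group
  have hlact : ∀ l m, lact f.φ (s * s') g (A'.sec (s' (g * A.bd a * g⁻¹))⁻¹ l * m) =
      A'.sec (s g * s' g)⁻¹ (A'.sec ((f.φ g)⁻¹ • (s' (g * A.bd a * g⁻¹))⁻¹) ((f.φ g)⁻¹ • l) *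
        (f.φ g)⁻¹ • m) := fun l m => by
    rw [lact_apply, smul_mul', smul_sec, Pi.mul_apply]
  have hY : ((f'.φ (A.bd a))⁻¹ • s' g * s' (A.bd a))⁻¹ =
      (s' (A.bd a))⁻¹ * (A'.bd (f.ψ a * s (A.bd a)))⁻¹ • (s' g)⁻¹ := by rw [hfa]; simp
  rw [hcomp, compP, compP, compT, compT, A.bd_smul, hlact, hl, hlast, hY, Pi.mul_apply, Pi.mul_apply,
    ← hid, f.φ_bd, ← lact_apply, ← inv_smul_eq hφ, ← lact_apply, sec_inv (s' g)⁻¹, mul_left_inj,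
    mul_right_inj]

end Comp

section LaxOperations

variable {A : TwoCrossedModule.{u}} {A' : TwoCrossedModule.{v}}

/-! ### Identities, concatenations and inverses of lax homotopies -/

/-- The identity lax homotopy. -/
def LaxHtpy.id (f : Hom A A') : LaxHtpy f f :=
  LaxHtpy.mk' 1 1 1 (fun g h => by simp) (fun g h i => by simp)
    (fun a b => by simp [pl_one_right, sec_one_right])
    (fun g a => by simp [pl_one_left, pl_one_right, sec_one_right])
    (fun g => by simp) (fun e => by simp) (fun l => by simp)

theorem compP_one_one {φ φ' : A.G →* A'.G} {s s' : A.G → A'.E} {P P' : A.G → A.G → A'.L}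
    (h : SMul φ s P) (h' : SMul φ' s' P') : compP φ φ' s s' P P' 1 1 = P' 1 1 * P 1 1 := by
  rw [compP, h.s_one, h'.s_one]
  simp only [map_one, inv_one, one_smul, inv_inv, mul_inv_rev, A'.pl_δ_δ, sec_δ, mul_sec]
  group

variable {f f' f'' f''' : Hom A A'}

/-- The concatenation of lax homotopies. -/
def LaxHtpy.comp (p : LaxHtpy f f') (q : LaxHtpy f' f'') : LaxHtpy f f'' :=
  LaxHtpy.mk' (p.s * q.s) (compT q.s p.t q.t) (compP f.φ f'.φ p.s q.s p.P q.P)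
    ((SMul.comp_iff p.φ_eq p.sMul).2 q.sMul)
    ((IsCocycle.comp_iff p.φ_eq p.sMul q.sMul p.isCocycle).2 q.isCocycle)
    ((TMul.comp_iff p.ψ_eq q.sMul p.tMul).2 q.tMul)
    ((TSmul.comp_iff p.φ_eq p.ψ_eq q.φ_eq q.ψ_eq q.sMul p.tSmul).2 q.tSmul)
    (fun g => by rw [q.φ_eq, p.φ_eq, Pi.mul_apply, map_mul, mul_assoc])
    (fun e => by rw [q.ψ_eq, p.ψ_eq, compT, map_mul, δ_sec, Pi.mul_apply]; group)
    (fun l => by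
      rw [q.μ_eq, p.μ_eq, compP_one_one p.sMul q.sMul, compT, A.bd_δ, q.sMul.s_one, inv_inv, sec_δ]
      group)

/-- What remains of associativity of `compP` once the common outer factors are removed: e = s(h), e'
= s'(h), p = P(g,h), and a, b are the translates by φ(h)⁻¹ of s'(g)⁻¹, s''(g)⁻¹. -/
theorem sec_pl_inv_mul_sec (e e' a b : A.E) (p : A.L) :
    A.pl (e * e')⁻¹ b * A.sec (A.bd e'⁻¹ • A.bd e⁻¹ • b)
      (A.sec e'⁻¹ (A.pl e⁻¹ a * A.sec (A.bd e⁻¹ • a) p)) =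
    A.sec e'⁻¹ (A.pl e⁻¹ (b * a) * A.sec (A.bd e⁻¹ • b) (A.sec (A.bd e⁻¹ • a) p)) *
      A.pl e'⁻¹ (A.bd e⁻¹ • b) := by
  rw [sec_bd_smul_sec, mul_inv_rev e e', pl_mul_left', pl_mul_right']
  simp only [sec_mul]
  group

theorem compP_assoc {φ φ' φ'' : A.G →* A'.G} {s s' s'' : A.G → A'.E} {P P' P'' : A.G → A.G → A'.L}
    (hφ : ∀ g, φ' g = φ g * A'.bd (s g)) (hφ' : ∀ g, φ'' g = φ' g * A'.bd (s' g)) :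
    compP φ φ'' (s * s') s'' (compP φ φ' s s' P P') P'' =
      compP φ φ' s (s' * s'') P (compP φ' φ'' s' s'' P' P'') := by
  funext g h
  obtain ⟨a, ha⟩ : ∃ x, x = (φ h)⁻¹ • s' g := ⟨_, rfl⟩
  obtain ⟨b, hb⟩ : ∃ x, x = (φ h)⁻¹ • s'' g := ⟨_, rfl⟩
  have key := sec_pl_inv_mul_sec (s h) (s' h) a⁻¹ b⁻¹ (P g h)
  have h1 : ((A'.bd (s' h))⁻¹ • (A'.bd (s h))⁻¹ • b * s'' h)⁻¹ =
      (s'' h)⁻¹ * A'.bd (s' h)⁻¹ • A'.bd (s h)⁻¹ • b⁻¹ := by simp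
  have h2 : ((A'.bd (s h))⁻¹ • a * s' h)⁻¹ = (s' h)⁻¹ * A'.bd (s h)⁻¹ • a⁻¹ := by simp
  have h3 : ((A'.bd (s h))⁻¹ • (a * b) * (s' h * s'' h))⁻¹ =
      (s'' h)⁻¹ * ((s' h)⁻¹ * (A'.bd (s h)⁻¹ • b⁻¹ * A'.bd (s h)⁻¹ • a⁻¹)) := by
    simp [mul_assoc]
  simp only [compP, Pi.mul_apply, inv_smul_eq hφ', inv_smul_eq hφ, smul_inv' (φ h)⁻¹,
    smul_mul' (φ h)⁻¹, ← ha, ← hb]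
  rw [h1, h2, h3, mul_inv_rev a b, mul_inv_rev (s' h), smul_inv' (A'.bd (s h))⁻¹ b]
  simp only [mul_sec, sec_mul, map_inv, smul_inv'] at key ⊢
  rw [← mul_assoc, ← mul_assoc, ← mul_assoc, mul_left_inj, ← mul_assoc, mul_left_inj, ← sec_mul,
    ← sec_mul, mul_assoc, key]
  simp only [sec_mul]

theorem LaxHtpy.ext_fun {p q : LaxHtpy f f'} (hs : ∀ g, p.s g = q.s g) (ht : ∀ e, p.t e = q.t e)
    (hP : ∀ g h, p.P g h = q.P g h) : p = q :=
  LaxHtpy.ext (funext hs) (funext ht) (funext fun g => funext fun h => hP g h)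

theorem LaxHtpy.comp_assoc (p : LaxHtpy f f') (q : LaxHtpy f' f'') (r : LaxHtpy f'' f''') :
    (p.comp q).comp r = p.comp (q.comp r) := by
  refine LaxHtpy.ext (mul_assoc p.s q.s r.s) ?_ (compP_assoc p.φ_eq q.φ_eq)
  funext e
  change A'.sec (r.s (A.bd e))⁻¹ (A'.sec (q.s (A.bd e))⁻¹ (p.t e) * q.t e) * r.t e =
    A'.sec (q.s (A.bd e) * r.s (A.bd e))⁻¹ (p.t e) *
      (A'.sec (r.s (A.bd e))⁻¹ (q.t e) * r.t e)
  rw [sec_mul, mul_inv_rev, mul_sec, mul_assoc]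

theorem LaxHtpy.id_comp (p : LaxHtpy f f') : (LaxHtpy.id f).comp p = p := by
  refine LaxHtpy.ext_fun (fun g => one_mul _) (fun e => ?_) (fun g h => ?_)
  · change A'.sec (p.s (A.bd e))⁻¹ 1 * p.t e = p.t e
    rw [sec_one_right, one_mul]
  · change A'.sec (p.s h)⁻¹ (A'.pl 1⁻¹ _) * A'.sec _ 1 * p.P g h = _
    rw [inv_one, pl_one_left, sec_one_right, sec_one_right, one_mul, one_mul]

theorem LaxHtpy.comp_id (p : LaxHtpy f f') : p.comp (LaxHtpy.id f') = p := by
  refine LaxHtpy.ext_fun (fun g => mul_one _) (fun e => ?_) (fun g h => ?_)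
  · change A'.sec 1⁻¹ (p.t e) * 1 = p.t e
    rw [inv_one, sec_one_left, mul_one]
  · change A'.sec 1⁻¹ (A'.pl (p.s h)⁻¹ ((f.φ h)⁻¹ • 1⁻¹)) *
      A'.sec ((f'.φ h)⁻¹ • 1 * 1)⁻¹ (p.P g h) * 1 = _
    simp [pl_one_right, sec_one_left]

/-- The second component of the inverse of a lax homotopy. -/
def invT (s : A.G → A'.E) (t : A.E → A'.L) (e : A.E) : A'.L := A'.sec (s (A.bd e)) (t e)⁻¹

/-- The third component of the inverse of a lax homotopy. -/
def invP (φ φ' : A.G →* A'.G) (s : A.G → A'.E) (P : A.G → A.G → A'.L) (g h : A.G) : A'.L :=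
  (A'.sec (s⁻¹ h)⁻¹ (A'.pl (s h)⁻¹ ((φ h)⁻¹ • (s⁻¹ g)⁻¹)) *
    A'.sec (((φ' h)⁻¹ • s⁻¹ g) * s⁻¹ h)⁻¹ (P g h))⁻¹

/-- `invP` is by design the inverse of the factor that precedes P' in `compP`. -/
theorem compP_invP (φ φ' : A.G →* A'.G) (s : A.G → A'.E) (P : A.G → A.G → A'.L) :
    compP φ φ' s s⁻¹ P (invP φ φ' s P) = 1 := by
  funext g h
  exact mul_inv_cancel _

theorem compT_invT (s : A.G → A'.E) (t : A.E → A'.L) : compT s⁻¹ t (invT s t) = 1 := by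
  funext e
  simp [compT, invT, sec_inv]

/-- The inverse of a lax homotopy. -/
def LaxHtpy.inv (p : LaxHtpy f f') : LaxHtpy f' f :=
  have hφ : ∀ g, f.φ g = f'.φ g * A'.bd (p.s⁻¹ g) := fun g => by simp [p.φ_eq]
  have hψ : ∀ e, f.ψ e = f'.ψ e * p.s⁻¹ (A.bd e) * A'.δ (invT p.s p.t e) := fun e => by
    rw [p.ψ_eq, invT, δ_sec, map_inv, Pi.inv_apply]; group
  -- Each axiom of the inverse is pulled back through a `comp_iff` to the same axiom for the
  -- identity.
  have hS : SMul f'.φ p.s⁻¹ (invP f.φ f'.φ p.s p.P) := by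
    rw [← SMul.comp_iff p.φ_eq p.sMul, compP_invP, mul_inv_cancel]
    exact (LaxHtpy.id f).sMul
  LaxHtpy.mk' p.s⁻¹ (invT p.s p.t) (invP f.φ f'.φ p.s p.P) hS
    (by
      rw [← IsCocycle.comp_iff p.φ_eq p.sMul hS p.isCocycle, compP_invP, mul_inv_cancel]
      exact (LaxHtpy.id f).isCocycle)
    (by
      rw [← TMul.comp_iff p.ψ_eq hS p.tMul, compP_invP, mul_inv_cancel, compT_invT]
      exact (LaxHtpy.id f).tMul)
    (by
      rw [← TSmul.comp_iff p.φ_eq p.ψ_eq hφ hψ hS p.tSmul, compP_invP, mul_inv_cancel, compT_invT]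
      exact (LaxHtpy.id f).tSmul)
    hφ hψ
    (fun l => by
      have h1 : invP f.φ f'.φ p.s p.P 1 1 = (p.P 1 1)⁻¹ := by
        rw [eq_inv_iff_mul_eq_one, ← compP_one_one p.sMul hS, compP_invP]; rfl
      rw [h1, invT, A.bd_δ, p.sMul.s_one, ← map_inv, sec_δ, p.μ_eq]
      group)

theorem LaxHtpy.comp_inv (p : LaxHtpy f f') : p.comp p.inv = LaxHtpy.id f :=
  LaxHtpy.ext (mul_inv_cancel p.s) (compT_invT _ _) (compP_invP _ _ _ _)

theorem LaxHtpy.inv_comp (p : LaxHtpy f f') : p.inv.comp p = LaxHtpy.id f' := by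
  have h : p.inv.comp p = (p.inv.comp p).comp (p.inv.comp p.inv.inv) := by
    rw [p.inv.comp_inv, LaxHtpy.comp_id]
  rw [h, LaxHtpy.comp_assoc, ← LaxHtpy.comp_assoc p, p.comp_inv, LaxHtpy.id_comp, p.inv.comp_inv]

/-! ### Changing a lax homotopy along a map `k` -/

/-- The innermost term of Ξ is the preimage of k(gi)⁻¹ under `lact φ s (g * i)`, and `lact_mul`
splits that map into two steps up to conjugation by P. Hence Ξ⁻¹P is a coboundary twist of P, which
makes the group action by k visible. -/
theorem Xi_eq {φ : A.G →* A'.G} {s : A.G → A'.E} {P : A.G → A.G → A'.L} (h : SMul φ s P)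
    (k : A.G → A'.L) (g i : A.G) : Xi φ s k (g * i) g i =
      P g i * (k (g * i))⁻¹ * (P g i)⁻¹ * (lact φ s i (k g) * k i) := by
  have h1 := h.lact_mul g i (φ (g * i) • A'.sec (s (g * i)) (k (g * i))⁻¹)
  rw [lact_smul_sec] at h1
  have h2 : Xi φ s k (g * i) g i =
      lact φ s i (lact φ s g (φ (g * i) • A'.sec (s (g * i)) (k (g * i))⁻¹) * k g) * k i := by
    rw [Xi, lact_apply, lact_apply, ← mul_smul]
  have h3 : ∀ x y p : A'.L, x = p⁻¹ * y * p → y = p * x * p⁻¹ := by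
    rintro x y p rfl; group
  rw [h2, map_mul, h3 _ _ _ h1, mul_assoc]

/-- The third component of the change of a lax homotopy along `k`. -/
def changeP (φ : A.G →* A'.G) (s : A.G → A'.E) (k : A.G → A'.L) (P : A.G → A.G → A'.L)
    (g h : A.G) : A'.L :=
  (lact φ s h (k g) * k h)⁻¹ * P g h * k (g * h)

theorem Xi_inv_mul {φ : A.G →* A'.G} {s : A.G → A'.E} {P : A.G → A.G → A'.L} (h : SMul φ s P)
    (k : A.G → A'.L) (g i : A.G) : (Xi φ s k (g * i) g i)⁻¹ * P g i = changeP φ s k P g i := by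
  rw [Xi_eq h, changeP]; group

theorem lact_mul_δ (φ : A.G →* A'.G) (s : A.G → A'.E) (k : A.G → A'.L) (h : A.G) (l : A'.L) :
    lact φ (fun g => s g * A'.δ (k g)) h l = (k h)⁻¹ * lact φ s h l * k h := by
  rw [lact_apply, mul_inv_rev, ← map_inv, δ_mul_sec, inv_inv, lact_apply]

theorem SMul.change {φ : A.G →* A'.G} {s : A.G → A'.E} {P : A.G → A.G → A'.L} (h : SMul φ s P)
    (k : A.G → A'.L) : SMul φ (fun g => s g * A'.δ (k g)) (changeP φ s k P) := fun g i => by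
  simp only [changeP, map_mul, map_inv, lact_apply, δ_sec, A'.δ_smul, smul_mul', h g i]
  group

theorem IsCocycle.change {φ : A.G →* A'.G} {s : A.G → A'.E} {P : A.G → A.G → A'.L}
    (h : SMul φ s P) (hP : IsCocycle φ s P) (k : A.G → A'.L) :
    IsCocycle φ (fun g => s g * A'.δ (k g)) (changeP φ s k P) := fun g i j => by
  have e := hP g i j
  have e1 := h.lact_mul i j (k g)
  simp only [lact_mul_δ, changeP, map_mul, map_inv, e1]
  rw [eq_mul_inv_of_mul_eq e, mul_assoc g i j]
  group

/-- The lax homotopy obtained from `p` by changing it along `k`. -/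
def LaxHtpy.change (p : LaxHtpy f f') (k : A.G → A'.L) : LaxHtpy f f' :=
  LaxHtpy.mk' (fun g => p.s g * A'.δ (k g)) (fun e => (k (A.bd e))⁻¹ * p.t e)
    (changeP f.φ p.s k p.P) (p.sMul.change k) (IsCocycle.change p.sMul p.isCocycle k)
    (fun a b => by
      have e := t_mul_change_identity (p.s (A.bd a)) (p.s (A.bd b)) (f.ψ b) (p.t a) (p.t b)
        (k (A.bd a)) (k (A.bd b))
      beta_reduce
      rw [← e, ← p.tMul a b, changeP, lact_apply, f.φ_bd, map_mul A.bd]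
      group)
    (fun g a => by
      have e := t_smul_change_identity (p.s (A.bd a)) (p.s g) (f.ψ a) (p.t a) (k g) (k (A.bd a))
      have hx : g * A.bd a * g⁻¹ * g = g * A.bd a := by group
      beta_reduce
      rw [← e, ← p.tSmul g a, changeP, changeP, lact_mul_δ, hx, A.bd_smul, ← f.φ_bd, ← lact_apply,
        map_mul _ _ (p.t _), map_inv]
      group)
    (fun g => by rw [p.φ_eq, map_mul, A'.bd_δ, mul_one])
    (fun e => by rw [p.ψ_eq, map_mul, map_inv]; group)
    (fun l => by
      rw [changeP, p.sMul.lact_one, A.bd_δ, mul_one, p.μ_eq]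
      group)

end LaxOperations

section LaxCells

variable {A : TwoCrossedModule.{u}} {A' : TwoCrossedModule.{v}} {f f' f'' f''' : Hom A A'}

/-! ### Lax 2-fold homotopies -/

theorem changeP_one (φ : A.G →* A'.G) (s : A.G → A'.E) (P : A.G → A.G → A'.L) :
    changeP φ s 1 P = P := by
  funext g h
  simp [changeP]

theorem LaxHtpy.change_one (p : LaxHtpy f f') : p.change 1 = p :=
  LaxHtpy.ext_fun (fun g => by simp [LaxHtpy.change, LaxHtpy.mk'])
    (fun e => by simp [LaxHtpy.change, LaxHtpy.mk'])
    (fun g h => congrFun (congrFun (changeP_one _ _ _) g) h)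

theorem LaxHtpy.change_mul (p : LaxHtpy f f') (k k' : A.G → A'.L) :
    p.change (k * k') = (p.change k).change k' := by
  refine LaxHtpy.ext_fun (fun g => ?_) (fun e => ?_) (fun g h => ?_)
  · simp [LaxHtpy.change, LaxHtpy.mk', mul_assoc]
  · simp [LaxHtpy.change, LaxHtpy.mk', mul_assoc]
  · simp only [LaxHtpy.change, LaxHtpy.mk', changeP, lact_mul_δ, Pi.mul_apply, map_mul]
    group

/-- δk already stands at the right end of s·s'·δk, so k passes through untouched: this is left
whiskering. -/
theorem LaxHtpy.comp_change (p : LaxHtpy f f') (q : LaxHtpy f' f'') (k : A.G → A'.L) :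
    p.comp (q.change k) = (p.comp q).change k := by
  refine LaxHtpy.ext_fun (fun g => ?_) (fun e => ?_) (fun g h => ?_)
  · exact (mul_assoc _ _ _).symm
  · change A'.sec (q.s (A.bd e) * A'.δ (k (A.bd e)))⁻¹ (p.t e) * ((k (A.bd e))⁻¹ * q.t e) =
      (k (A.bd e))⁻¹ * (A'.sec (q.s (A.bd e))⁻¹ (p.t e) * q.t e)
    rw [mul_inv_rev, ← map_inv, δ_mul_sec]; group
  · change compP f.φ f'.φ p.s (fun g => q.s g * A'.δ (k g)) p.P (changeP f'.φ q.s k q.P) g h =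
      changeP f.φ (p.s * q.s) k (compP f.φ f'.φ p.s q.s p.P q.P) g h
    have h1 : (f.φ h)⁻¹ • ((A'.δ (k g))⁻¹ * (q.s g)⁻¹) =
        A'.δ ((f.φ h)⁻¹ • (k g)⁻¹) * (f.φ h)⁻¹ • (q.s g)⁻¹ := by
      rw [smul_mul', A'.δ_smul, map_inv]
    have h2 : ((f'.φ h)⁻¹ • (q.s g * A'.δ (k g)) * (q.s h * A'.δ (k h)))⁻¹ =
        A'.δ (k h)⁻¹ * ((q.s h)⁻¹ * (A'.δ ((f'.φ h)⁻¹ • k g)⁻¹ *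
          (A'.bd (p.s h))⁻¹ • (f.φ h)⁻¹ • (q.s g)⁻¹)) := by
      simp [A'.δ_smul, inv_smul_eq p.φ_eq, mul_assoc]
    have h3 : ((f'.φ h)⁻¹ • q.s g * q.s h)⁻¹ =
        (q.s h)⁻¹ * (A'.bd (p.s h))⁻¹ • (f.φ h)⁻¹ • (q.s g)⁻¹ := by
      simp [inv_smul_eq p.φ_eq]
    simp only [compP, changeP, h2, h3, lact_apply, Pi.mul_apply, mul_inv_rev (q.s g),
      mul_inv_rev (p.s h), h1]
    rw [pl_δ_mul_right, mul_inv_rev (q.s h), ← map_inv A'.δ, δ_mul_sec, δ_mul_sec,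
      mul_sec (q.s h)⁻¹ (A'.δ _ * _), δ_mul_sec]
    simp only [inv_smul_eq p.φ_eq, map_inv, inv_inv, smul_inv', sec_mul, sec_inv, mul_sec]
    group

/-- Here δk must be moved past s', which twists k by s'⁻¹: this is right whiskering. -/
theorem LaxHtpy.change_comp (p : LaxHtpy f f') (q : LaxHtpy f' f'') (k : A.G → A'.L) :
    (p.change k).comp q = (p.comp q).change (fun g => A'.sec (q.s g)⁻¹ (k g)) := by
  refine LaxHtpy.ext_fun (fun g => ?_) (fun e => ?_) (fun g h => ?_)
  · change p.s g * A'.δ (k g) * q.s g = p.s g * q.s g * A'.δ (A'.sec (q.s g)⁻¹ (k g))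
    rw [δ_sec]; group
  · change A'.sec (q.s (A.bd e))⁻¹ ((k (A.bd e))⁻¹ * p.t e) * q.t e =
      (A'.sec (q.s (A.bd e))⁻¹ (k (A.bd e)))⁻¹ * (A'.sec (q.s (A.bd e))⁻¹ (p.t e) * q.t e)
    rw [sec_mul, sec_inv, mul_assoc]
  · change compP f.φ f'.φ (fun g => p.s g * A'.δ (k g)) q.s (changeP f.φ p.s k p.P) q.P g h =
      changeP f.φ (p.s * q.s) (fun g => A'.sec (q.s g)⁻¹ (k g))
        (compP f.φ f'.φ p.s q.s p.P q.P) g h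
    have h3 : ((f'.φ h)⁻¹ • q.s g * q.s h)⁻¹ =
        (q.s h)⁻¹ * (A'.bd (p.s h)⁻¹ • (f.φ h)⁻¹ • (q.s g)⁻¹) := by
      simp [inv_smul_eq p.φ_eq]
    have h5 : (p.s h * A'.δ (k h))⁻¹ = A'.δ (k h)⁻¹ * (p.s h)⁻¹ := by simp
    have h4 : (q.s (g * h))⁻¹ = A'.δ (q.P g h)⁻¹ *
        ((q.s h)⁻¹ * (A'.bd (p.s h)⁻¹ • (f.φ h)⁻¹ • (q.s g)⁻¹)) := by
      rw [q.s_mul, mul_inv_rev _ (A'.δ _), h3, map_inv A'.δ]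
    have e1 := sec_bd_smul_sec (p.s h)⁻¹ ((f.φ h)⁻¹ • (q.s g)⁻¹) ((f.φ h)⁻¹ • k g)
    simp only [compP, changeP, h3, h4, h5, lact_apply, Pi.mul_apply, δ_mul_sec, pl_δ_mul_left',
      mul_inv_rev (p.s h)]
    rw [smul_inv' (f.φ h)⁻¹] at e1
    simp only [smul_sec, mul_sec, sec_mul, sec_inv, e1, smul_inv' (f.φ h)⁻¹]
    group

theorem LaxHtpy₂.eq_change {p q : LaxHtpy f f'} (η : LaxHtpy₂ p q) : q = p.change η.k :=
  LaxHtpy.ext_fun η.s_eq η.t_eq (fun g h => by rw [η.P_eq, Xi_inv_mul p.sMul]; rfl)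

/-- The lax 2-fold homotopy with underlying map `k`. -/
def LaxHtpy₂.ofEq {p q : LaxHtpy f f'} (k : A.G → A'.L) (h : q = p.change k) : LaxHtpy₂ p q where
  k := k
  s_eq g := by rw [h]; rfl
  t_eq e := by rw [h]; rfl
  P_eq a b := by rw [Xi_inv_mul p.sMul, h]; rfl

/-- The identity 2-morphism. -/
def LaxHtpy₂.id (p : LaxHtpy f f') : LaxHtpy₂ p p := .ofEq 1 p.change_one.symm

/-- Vertical composition. -/
def LaxHtpy₂.comp {p q r : LaxHtpy f f'} (η : LaxHtpy₂ p q) (θ : LaxHtpy₂ q r) : LaxHtpy₂ p r :=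
  .ofEq (η.k * θ.k) (by rw [LaxHtpy.change_mul, ← η.eq_change, ← θ.eq_change])

/-- Vertical inverse. -/
def LaxHtpy₂.inv {p q : LaxHtpy f f'} (η : LaxHtpy₂ p q) : LaxHtpy₂ q p :=
  .ofEq η.k⁻¹ (by
    have h := congrArg (LaxHtpy.change · η.k⁻¹) η.eq_change
    rwa [← LaxHtpy.change_mul, mul_inv_cancel, LaxHtpy.change_one, eq_comm] at h)

/-- Right whiskering. -/
def LaxHtpy₂.whiskerRight {p q : LaxHtpy f f'} (η : LaxHtpy₂ p q) (r : LaxHtpy f' f'') :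
    LaxHtpy₂ (p.comp r) (q.comp r) :=
  .ofEq (fun g => A'.sec (r.s g)⁻¹ (η.k g)) (by rw [← LaxHtpy.change_comp, ← η.eq_change])

/-- Left whiskering. -/
def LaxHtpy₂.whiskerLeft (r : LaxHtpy f f') {p q : LaxHtpy f' f''} (η : LaxHtpy₂ p q) :
    LaxHtpy₂ (r.comp p) (r.comp q) :=
  .ofEq η.k (by rw [← LaxHtpy.comp_change, ← η.eq_change])

end LaxCells

/-! ### 2-groupoids from invertible 1-cells and 2-cells labelled by a group -/

section Labelled

open Bicategory

/-- Data for a 2-groupoid whose 2-morphisms are determined by elements of a group `M`. -/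
structure LabelledCells (Obj : Type u) (Cell₁ : Obj → Obj → Type v)
    (Cell₂ : ∀ ⦃a b : Obj⦄, Cell₁ a b → Cell₁ a b → Type w) (M : Type*) [Group M] where
  id₁ : ∀ a, Cell₁ a a
  comp₁ : ∀ {a b c}, Cell₁ a b → Cell₁ b c → Cell₁ a c
  id_comp : ∀ {a b} (p : Cell₁ a b), comp₁ (id₁ a) p = p
  comp_id : ∀ {a b} (p : Cell₁ a b), comp₁ p (id₁ b) = p
  assoc : ∀ {a b c d} (p : Cell₁ a b) (q : Cell₁ b c) (r : Cell₁ c d),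
    comp₁ (comp₁ p q) r = comp₁ p (comp₁ q r)
  inv₁ : ∀ {a b} (p : Cell₁ a b), ∃ q : Cell₁ b a, comp₁ p q = id₁ a ∧ comp₁ q p = id₁ b
  label : ∀ {a b} {p q : Cell₁ a b}, Cell₂ p q → M
  label_injective : ∀ {a b} {p q : Cell₁ a b} (η θ : Cell₂ p q), label η = label θ → η = θ
  id₂ : ∀ {a b} (p : Cell₁ a b), Cell₂ p p
  label_id₂ : ∀ {a b} (p : Cell₁ a b), label (id₂ p) = 1
  comp₂ : ∀ {a b} {p q r : Cell₁ a b}, Cell₂ p q → Cell₂ q r → Cell₂ p r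
  label_comp₂ : ∀ {a b} {p q r : Cell₁ a b} (η : Cell₂ p q) (θ : Cell₂ q r),
    label (comp₂ η θ) = label η * label θ
  inv₂ : ∀ {a b} {p q : Cell₁ a b}, Cell₂ p q → Cell₂ q p
  label_inv₂ : ∀ {a b} {p q : Cell₁ a b} (η : Cell₂ p q), label (inv₂ η) = (label η)⁻¹
  whiskerLeft : ∀ {a b c} (r : Cell₁ a b) {p q : Cell₁ b c}, Cell₂ p q →
    Cell₂ (comp₁ r p) (comp₁ r q)
  label_whiskerLeft : ∀ {a b c} (r : Cell₁ a b) {p q : Cell₁ b c} (η : Cell₂ p q),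
    label (whiskerLeft r η) = label η
  act : ∀ {a b}, Cell₁ a b → M →* M
  act_id : ∀ a m, act (id₁ a) m = m
  act_comp : ∀ {a b c} (p : Cell₁ a b) (q : Cell₁ b c) (m : M),
    act (comp₁ p q) m = act q (act p m)
  act_label : ∀ {a b} {p q : Cell₁ a b} (η : Cell₂ p q) (m : M),
    act p m * label η = label η * act q m
  whiskerRight : ∀ {a b c} {p q : Cell₁ a b}, Cell₂ p q → ∀ r : Cell₁ b c,
    Cell₂ (comp₁ p r) (comp₁ q r)
  label_whiskerRight : ∀ {a b c} {p q : Cell₁ a b} (η : Cell₂ p q) (r : Cell₁ b c),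
    label (whiskerRight η r) = act r (label η)

namespace LabelledCells

variable {Obj : Type u} {Cell₁ : Obj → Obj → Type v}
    {Cell₂ : ∀ ⦃a b : Obj⦄, Cell₁ a b → Cell₁ a b → Type w} {M : Type*} [Group M]
    (D : LabelledCells Obj Cell₁ Cell₂ M)

/-- The category of 1-morphisms. -/
@[reducible]
def homCategory (a b : Obj) : Category.{w} (Cell₁ a b) where
  Hom p q := Cell₂ p q
  id p := D.id₂ p
  comp η θ := D.comp₂ η θ
  id_comp η := D.label_injective _ _ (by rw [D.label_comp₂, D.label_id₂, one_mul])
  comp_id η := D.label_injective _ _ (by rw [D.label_comp₂, D.label_id₂, mul_one])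
  assoc η θ ζ := D.label_injective _ _ (by simp only [D.label_comp₂, mul_assoc])

theorem label_eqToHom {a b : Obj} {p q : Cell₁ a b} (h : p = q) :
    letI := D.homCategory a b
    D.label (eqToHom h) = 1 := by
  subst h
  exact D.label_id₂ p

theorem label_eqToIso_inv {a b : Obj} {p q : Cell₁ a b} (h : p = q) :
    letI := D.homCategory a b
    D.label (eqToIso h).inv = 1 := by
  subst h
  exact D.label_id₂ p

theorem label_comp {a b : Obj} {p q r : Cell₁ a b} (η : Cell₂ p q) (θ : Cell₂ q r) :
    letI := D.homCategory a b
    D.label (CategoryStruct.comp (X := p) (Y := q) (Z := r) η θ) = D.label η * D.label θ :=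
  D.label_comp₂ η θ

theorem label_id {a b : Obj} (p : Cell₁ a b) :
    letI := D.homCategory a b
    D.label (𝟙 p) = 1 :=
  D.label_id₂ p

/-- The underlying bicategory. -/
@[reducible]
def bicategory : Bicategory.{w, v} Obj where
  Hom := Cell₁
  id := D.id₁
  comp := D.comp₁
  homCategory := D.homCategory
  whiskerLeft := D.whiskerLeft
  whiskerRight := D.whiskerRight
  -- Structural isomorphisms come from equalities and have label 1, so they disappear from every
  -- coherence law.
  associator {a b c d} p q r := letI := D.homCategory a d; eqToIso (D.assoc p q r)
  leftUnitor {a b} p := letI := D.homCategory a b; eqToIso (D.id_comp p)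
  rightUnitor {a b} p := letI := D.homCategory a b; eqToIso (D.comp_id p)
  whiskerLeft_id _ _ := D.label_injective _ _
    (by simp only [D.label_whiskerLeft, D.label_id])
  whiskerLeft_comp _ _ _ _ _ _ := D.label_injective _ _
    (by simp only [D.label_whiskerLeft, D.label_comp])
  id_whiskerLeft _ := D.label_injective _ _
    (by simp only [D.label_whiskerLeft, D.label_comp, D.label_eqToHom, D.label_eqToIso_inv,
      eqToIso.hom, one_mul, mul_one])
  comp_whiskerLeft _ _ _ _ _ := D.label_injective _ _
    (by simp only [D.label_whiskerLeft, D.label_comp, D.label_eqToHom, D.label_eqToIso_inv,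
      eqToIso.hom, one_mul, mul_one])
  id_whiskerRight _ _ := D.label_injective _ _
    (by simp only [D.label_whiskerRight, D.label_id, map_one])
  comp_whiskerRight _ _ _ := D.label_injective _ _
    (by simp only [D.label_whiskerRight, D.label_comp, map_mul])
  whiskerRight_id _ := D.label_injective _ _
    (by simp only [D.label_whiskerRight, D.label_comp, D.label_eqToHom, D.label_eqToIso_inv,
      eqToIso.hom, one_mul, mul_one, D.act_id])
  whiskerRight_comp _ _ _ := D.label_injective _ _
    (by simp only [D.label_whiskerRight, D.label_comp, D.label_eqToHom, D.label_eqToIso_inv,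
      eqToIso.hom, one_mul, mul_one, D.act_comp])
  whisker_assoc _ _ _ _ _ := D.label_injective _ _
    (by simp only [D.label_whiskerRight, D.label_whiskerLeft, D.label_comp, D.label_eqToHom,
      D.label_eqToIso_inv, eqToIso.hom, one_mul, mul_one])
  -- The interchange law on labels is exactly `act_label`.
  whisker_exchange _ _ := D.label_injective _ _
    (by simp only [D.label_whiskerRight, D.label_whiskerLeft, D.label_comp, D.act_label])
  pentagon _ _ _ _ := D.label_injective _ _
    (by simp only [D.label_whiskerRight, D.label_whiskerLeft, D.label_comp, D.label_eqToHom,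
      eqToIso.hom, one_mul, map_one])
  triangle _ _ := D.label_injective _ _
    (by simp only [D.label_whiskerRight, D.label_whiskerLeft, D.label_comp, D.label_eqToHom,
      eqToIso.hom, one_mul, map_one])

/-- The 2-groupoid given by labelled cells. -/
def twoGroupoid : TwoGroupoidOn Obj Cell₁ Cell₂ where
  bicategory := D.bicategory
  strict := @Bicategory.Strict.mk Obj D.bicategory D.id_comp D.comp_id D.assoc
    (fun _ => rfl) (fun _ => rfl) (fun _ _ _ => rfl)
  cell₁ := Equiv.refl _
  cell₂ := Equiv.refl _
  inv₁ := D.inv₁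
  inv₂ {a b p q} η := by
    let := D.homCategory a b
    exact ⟨D.inv₂ η, D.label_injective _ _ (by
        rw [D.label_comp, D.label_inv₂, D.label_id, mul_inv_cancel]),
      D.label_injective _ _ (by rw [D.label_comp, D.label_inv₂, D.label_id, inv_mul_cancel])⟩

end LabelledCells

end Labelled

section LaxTwoGroupoid

variable {A : TwoCrossedModule.{u}} {A' : TwoCrossedModule.{v}}

/-! ### The 2-groupoid of lax homotopies -/

/-- At a = gi the terms φ(gi)⁻¹φ(gi) vanish. The product φ(i)⁻¹▷s(g)·s(i) differs from s(gi) only by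
δP, so the last two liftings of Θ merge into one with first argument δP(g,i). -/
theorem theta_eq {φ φ' : A.G →* A'.G} {s s' : A.G → A'.E} {P P' : A.G → A.G → A'.L}
    (hφ : ∀ g, φ' g = φ g * A'.bd (s g)) (h : SMul φ s P) (h' : SMul φ' s' P') (g i : A.G) :
    Theta φ φ' s s' (g * i) g i =
      compP φ φ' s s' P P' g i * (P g i)⁻¹ * (P' g i)⁻¹ := by
  have h1 : ((φ i)⁻¹ • s g * s i)⁻¹ = A'.δ (P g i) * (s (g * i))⁻¹ := by rw [h g i]; group
  have h2 : ((φ' i)⁻¹ • s' g * s' i)⁻¹ = A'.δ (P' g i) * (s' (g * i))⁻¹ := by rw [h' g i]; group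
  have h3 : (φ' (g * i))⁻¹ * φ (g * i) = A'.bd (A'.δ (P g i) * (s (g * i))⁻¹) := by
    rw [hφ, map_mul A'.bd, A'.bd_δ, map_inv A'.bd]; group
  have h4 : A'.pl (A'.δ (P g i) * (s (g * i))⁻¹) (s (g * i) * s' (g * i) * (s (g * i))⁻¹) *
      A'.bd (A'.δ (P g i) * (s (g * i))⁻¹) • A'.pl (s (g * i)) (s' (g * i)) =
      P g i * A'.sec (s' (g * i)) (P g i)⁻¹ := by
    rw [← A'.pl_mul_left, inv_mul_cancel_right, pl_δ_left]
  rw [Theta, inv_mul_cancel, one_smul, h1, h2, h3, h4, compP, h2, sec_mul, mul_sec (A'.δ _),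
    mul_sec (A'.δ _), sec_inv_sec, sec_δ, sec_δ]
  group

theorem compP_eq_theta {φ φ' : A.G →* A'.G} {s s' : A.G → A'.E} {P P' : A.G → A.G → A'.L}
    (hφ : ∀ g, φ' g = φ g * A'.bd (s g)) (h : SMul φ s P) (h' : SMul φ' s' P') (g i : A.G) :
    compP φ φ' s s' P P' g i = Theta φ φ' s s' (g * i) g i * P' g i * P g i := by
  rw [theta_eq hφ h h']; group

/-- The map on functions `A.G → A'.L` induced by the secondary actions of the values of `s`. -/
def secPiHom {ι : Type*} (s : ι → A'.E) : (ι → A'.L) →* (ι → A'.L) :=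
  MonoidHom.pi fun i => (secHom (s i)⁻¹).comp (Pi.evalMonoidHom _ i)

theorem secPiHom_apply {ι : Type*} (s : ι → A'.E) (m : ι → A'.L) (i : ι) :
    secPiHom s m i = A'.sec (s i)⁻¹ (m i) := rfl

theorem secPiHom_one {ι : Type*} (m : ι → A'.L) : secPiHom (1 : ι → A'.E) m = m := by
  funext i; simp [secPiHom_apply, sec_one_left]

theorem secPiHom_mul {ι : Type*} (s s' : ι → A'.E) (m : ι → A'.L) :
    secPiHom (s * s') m = secPiHom s' (secPiHom s m) := by
  funext i; simp [secPiHom_apply, mul_sec]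

theorem secPiHom_mul_eq {ι : Type*} {s s' : ι → A'.E} {k : ι → A'.L}
    (h : ∀ i, s' i = s i * A'.δ (k i)) (m : ι → A'.L) :
    secPiHom s m * k = k * secPiHom s' m := by
  funext i
  simp only [Pi.mul_apply, secPiHom_apply, h, mul_inv_rev, ← map_inv, δ_mul_sec]
  group

variable (A A')

/-- The lax homotopies and lax 2-fold homotopies, labelled by their underlying maps. -/
def laxCells : LabelledCells (Hom A A') LaxHtpy (fun _ _ => LaxHtpy₂) (A.G → A'.L) where
  id₁ := LaxHtpy.id
  comp₁ := LaxHtpy.comp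
  id_comp := LaxHtpy.id_comp
  comp_id := LaxHtpy.comp_id
  assoc := LaxHtpy.comp_assoc
  inv₁ p := ⟨p.inv, p.comp_inv, p.inv_comp⟩
  label := LaxHtpy₂.k
  label_injective _ _ h := LaxHtpy₂.ext h
  id₂ := LaxHtpy₂.id
  label_id₂ _ := rfl
  comp₂ := LaxHtpy₂.comp
  label_comp₂ _ _ := rfl
  inv₂ := LaxHtpy₂.inv
  label_inv₂ _ := rfl
  whiskerLeft := LaxHtpy₂.whiskerLeft
  label_whiskerLeft _ _ _ _ := rfl
  act r := secPiHom r.s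
  act_id _ := secPiHom_one
  act_comp p q := secPiHom_mul p.s q.s
  act_label η := secPiHom_mul_eq η.s_eq
  whiskerRight := LaxHtpy₂.whiskerRight
  label_whiskerRight _ _ := rfl

variable {A A'}

theorem LaxHtpy.eq_inv {f f' : Hom A A'} {p : LaxHtpy f f'} {q : LaxHtpy f' f}
    (h : p.comp q = .id f) : q = p.inv := by
  rw [← q.id_comp, ← p.inv_comp, LaxHtpy.comp_assoc, h, LaxHtpy.comp_id]

theorem isHOMLax_twoGroupoid : IsHOMLax (laxCells A A').twoGroupoid where
  id₁ _ := ⟨fun _ => rfl, fun _ => rfl, fun _ _ => rfl⟩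
  comp₁ p q := ⟨fun _ => rfl, fun _ => rfl,
    compP_eq_theta (LaxHtpy.φ_eq p) (LaxHtpy.sMul p) (LaxHtpy.sMul q)⟩
  inv₁ {f f'} p q h _ := by
    obtain rfl : q = LaxHtpy.inv p := LaxHtpy.eq_inv h
    refine ⟨fun _ => rfl, fun _ => rfl, fun g i => ?_⟩
    have e := compP_eq_theta (LaxHtpy.φ_eq p) (LaxHtpy.sMul p) (LaxHtpy.sMul (LaxHtpy.inv p)) g i
    have e' : compP f.φ f'.φ (LaxHtpy.s p) (LaxHtpy.s (LaxHtpy.inv p)) (LaxHtpy.P p)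
      (LaxHtpy.P (LaxHtpy.inv p)) g i = 1 := congrFun (congrFun (compP_invP _ _ _ _) g) i
    rw [e', eq_comm, mul_eq_one_iff_eq_inv] at e
    exact eq_inv_mul_of_mul_eq e
  id₂ _ _ := rfl
  vcomp _ _ _ := rfl
  whiskerRight _ _ _ := rfl
  whiskerLeft _ _ _ _ _ := rfl

end LaxTwoGroupoid

variable {A : TwoCrossedModule.{u}} {A' : TwoCrossedModule.{v}}

/-! ### Trivialising cocycles over a free group -/

section Trivialise

variable {φ : A.G →* A'.G} {s : A.G → A'.E} {P : A.G → A.G → A'.L}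

/-- The extension of `A.G` by `A'.L` given by a lax derivation. -/
@[ext]
structure CocycleExt (h : SMul φ s P) (hP : IsCocycle φ s P) where
  fst : A.G
  snd : A'.L

theorem IsCocycle.one_left (hP : IsCocycle φ s P) (g : A.G) : P 1 g = lact φ s g (P 1 1) := by
  have e := hP 1 1 g
  rw [one_mul, one_mul, mul_left_inj] at e
  exact e.symm

variable {h : SMul φ s P} {hP : IsCocycle φ s P}

/-- The twist is chosen so that g ↦ (g, k(g)) is multiplicative exactly when k trivialises P.
Associativity combines the cocycle identity with `lact_mul`. -/
instance : Mul (CocycleExt h hP) :=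
  ⟨fun x y => ⟨x.fst * y.fst, (P x.fst y.fst)⁻¹ * lact φ s y.fst x.snd * y.snd⟩⟩

/-- P is not assumed normalised, so the unit carries P(1,1). -/
instance : One (CocycleExt h hP) := ⟨⟨1, P 1 1⟩⟩

instance : Inv (CocycleExt h hP) :=
  ⟨fun x => ⟨x.fst⁻¹, φ x.fst • A'.sec (s x.fst) (P x.fst⁻¹ x.fst * P 1 1 * x.snd⁻¹)⟩⟩

theorem CocycleExt.mul_def (x y : CocycleExt h hP) :
    x * y = ⟨x.fst * y.fst, (P x.fst y.fst)⁻¹ * lact φ s y.fst x.snd * y.snd⟩ := rfl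

instance : Group (CocycleExt h hP) := Group.ofLeftAxioms
  (fun x y z => by
    have e := eq_mul_inv_of_mul_eq (hP x.fst y.fst z.fst)
    simp only [CocycleExt.mul_def, mul_assoc, CocycleExt.mk.injEq, true_and, h.lact_mul, map_mul,
      map_inv, e]
    group)
  (fun x => by
    change (⟨1 * x.fst, (P 1 x.fst)⁻¹ * lact φ s x.fst (P 1 1) * x.snd⟩ : CocycleExt h hP) = x
    rw [hP.one_left, inv_mul_cancel, one_mul, one_mul])
  (fun x => by
    change (⟨x.fst⁻¹ * x.fst, (P x.fst⁻¹ x.fst)⁻¹ * lact φ s x.fst (φ x.fst • A'.sec (s x.fst)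
      (P x.fst⁻¹ x.fst * P 1 1 * x.snd⁻¹)) * x.snd⟩ : CocycleExt h hP) = ⟨1, P 1 1⟩
    rw [lact_smul_sec, inv_mul_cancel, CocycleExt.mk.injEq]
    exact ⟨rfl, by group⟩)

/-- The projection of the extension onto `A.G`. -/
def CocycleExt.fstHom (h : SMul φ s P) (hP : IsCocycle φ s P) : CocycleExt h hP →* A.G where
  toFun := CocycleExt.fst
  map_one' := rfl
  map_mul' _ _ := rfl

/-- `k` changes the lax derivation `(s, P)` to a strict one. -/
def Trivialises (φ : A.G →* A'.G) (s : A.G → A'.E) (P : A.G → A.G → A'.L) (k : A.G → A'.L) :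
    Prop :=
  ∀ g i, P g i * k (g * i) = lact φ s i (k g) * k i

/-- The section of the extension defined by a trivialisation. -/
def Trivialises.sectionHom {k : A.G → A'.L} (hk : Trivialises φ s P k) (h : SMul φ s P)
    (hP : IsCocycle φ s P) : A.G →* CocycleExt h hP :=
  MonoidHom.mk' (fun g => ⟨g, k g⟩) fun g i => by
    rw [CocycleExt.mul_def, CocycleExt.mk.injEq, mul_assoc, ← hk g i, inv_mul_cancel_left]
    exact ⟨rfl, rfl⟩

variable {ι : Type*} (b : FreeGroupBasis ι A.G)

theorem Trivialises.unique {k k' : A.G → A'.L} (hk : Trivialises φ s P k)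
    (hk' : Trivialises φ s P k') (h : SMul φ s P) (hP : IsCocycle φ s P)
    (e : ∀ i, k (b i) = k' (b i)) : k = k' := by
  have e' : hk.sectionHom h hP = hk'.sectionHom h hP :=
    b.ext_hom _ _ fun i => CocycleExt.ext rfl (e i)
  funext g
  exact congrArg CocycleExt.snd (DFunLike.congr_fun e' g)

/-- Freeness extends b ↦ (b, 1) to a homomorphism into the extension. It is a section, since its
first component is the identity on the basis, and its second component is k. -/
theorem exists_trivialises (h : SMul φ s P) (hP : IsCocycle φ s P) :
    ∃ k, Trivialises φ s P k ∧ ∀ i, k (b i) = 1 := by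
  obtain ⟨X, hX⟩ : ∃ X : A.G →* CocycleExt h hP, ∀ i, X (b i) = ⟨b i, 1⟩ :=
    ⟨b.lift fun i => ⟨b i, 1⟩, fun i => congrFun (b.lift.symm_apply_apply _) i⟩
  have hf : (CocycleExt.fstHom h hP).comp X = MonoidHom.id _ :=
    b.ext_hom _ _ fun i => congrArg CocycleExt.fst (hX i)
  have hf' : ∀ g, (X g).fst = g := DFunLike.congr_fun hf
  refine ⟨fun g => (X g).snd, fun g i => ?_, fun i => congrArg CocycleExt.snd (hX i)⟩
  simp only [map_mul, CocycleExt.mul_def, hf']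
  group

theorem trivialises_iff {k : A.G → A'.L} : Trivialises φ s P k ↔ changeP φ s k P = 1 := by
  rw [funext_iff]
  refine forall_congr' fun g => ?_
  rw [funext_iff]
  refine forall_congr' fun i => ?_
  rw [changeP, mul_assoc, Pi.one_apply, Pi.one_apply, inv_mul_eq_one, eq_comm]

end Trivialise

/-! ### Strict homotopies as lax homotopies with trivial cocycle -/

section Strictify

variable {f f' f'' f''' : Hom A A'}

theorem strict_t_mul_eq (f : Hom A A') (s : A.G → A'.E) (x : A.E) (e : A'.E) (l : A'.L) :
    A'.sec (f.ψ x * s (A.bd x))⁻¹ (A'.pl (f.ψ x) ((f.φ (A.bd x))⁻¹ • e) * l) =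
      A'.sec (s (A.bd x))⁻¹ ((A'.pl (f.ψ x)⁻¹ e)⁻¹ * A'.sec (f.ψ x)⁻¹ l) := by
  rw [mul_inv_rev, mul_sec, sec_mul (f.ψ x)⁻¹, sec_inv_pl, f.φ_bd, smul_inv_smul]

/-- A homotopy as a lax homotopy. -/
def Htpy.toLax (p : Htpy f f') : LaxHtpy f f' where
  s := p.s
  t := p.t
  P := 1
  bd_s_mul g h := by rw [p.isQuadraticDerivation.s_mul]
  s_mul g h := by simpa using p.isQuadraticDerivation.s_mul g h
  t_mul a c := by
    rw [p.isQuadraticDerivation.t_mul, strict_t_mul_eq]; simp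
  t_smul g a := by
    rw [p.isQuadraticDerivation.t_smul]; simp
  P_cocycle g h i := by simp [sec_one_right]
  φ_eq := p.φ_eq
  ψ_eq := p.ψ_eq
  μ_eq l := by simpa using p.μ_eq l

/-- A lax homotopy with trivial cocycle as a homotopy. -/
def LaxHtpy.toHtpy (p : LaxHtpy f f') (hp : p.P = 1) : Htpy f f' where
  s := p.s
  t := p.t
  isQuadraticDerivation :=
    { s_mul := fun g h => by simpa [hp] using p.s_mul g h
      t_mul := fun a c => by rw [strict_t_mul_eq, ← p.t_mul, hp]; simp
      t_smul := fun g a => by rw [p.t_smul, hp]; simp }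
  φ_eq := p.φ_eq
  ψ_eq := p.ψ_eq
  μ_eq l := by simpa [hp] using p.μ_eq l

theorem Htpy.toLax_injective : Function.Injective (Htpy.toLax (f := f) (f' := f')) :=
  fun _ _ h => Htpy.ext (congrArg LaxHtpy.s h) (congrArg LaxHtpy.t h)

theorem LaxHtpy.toLax_toHtpy (p : LaxHtpy f f') (hp : p.P = 1) : (p.toHtpy hp).toLax = p :=
  LaxHtpy.ext rfl rfl hp.symm

theorem Htpy₂.trivialises {p q : Htpy f f'} (η : Htpy₂ p q) : Trivialises f.φ p.s 1 η.k :=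
  fun g i => by rw [η.k_mul, lact_apply]; exact one_mul _

theorem Htpy₂.eq_change {p q : Htpy f f'} (η : Htpy₂ p q) : q.toLax = p.toLax.change η.k :=
  LaxHtpy.ext (funext η.s_eq) (funext η.t_eq) (trivialises_iff.1 η.trivialises).symm

/-- The 2-fold homotopy with underlying map `k`. -/
def Htpy₂.ofEq {p q : Htpy f f'} (k : A.G → A'.L) (h : q.toLax = p.toLax.change k) :
    Htpy₂ p q where
  k := k
  k_mul g i := by
    have e : Trivialises f.φ p.s 1 k :=
      trivialises_iff.2 (congrArg LaxHtpy.P h).symm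
    have e' := e g i
    rwa [lact_apply, Pi.one_apply, Pi.one_apply, one_mul] at e'
  s_eq g := congrFun (congrArg LaxHtpy.s h) g
  t_eq e := congrFun (congrArg LaxHtpy.t h) e

variable {ι : Type*} (b : FreeGroupBasis ι A.G)

theorem Htpy₂.ext_basis {p q : Htpy f f'} {η θ : Htpy₂ p q}
    (h : ∀ i, η.k (b i) = θ.k (b i)) : η = θ :=
  Htpy₂.ext (η.trivialises.unique b θ.trivialises p.toLax.sMul p.toLax.isCocycle h)

/-- The map changing a lax homotopy into a strict one, trivial on the basis. -/
noncomputable def LaxHtpy.strictifier (p : LaxHtpy f f') : A.G → A'.L :=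
  (exists_trivialises b p.sMul p.isCocycle).choose

theorem LaxHtpy.trivialises_strictifier (p : LaxHtpy f f') :
    Trivialises f.φ p.s p.P (p.strictifier b) :=
  (exists_trivialises b p.sMul p.isCocycle).choose_spec.1

theorem LaxHtpy.strictifier_basis (p : LaxHtpy f f') (i : ι) : p.strictifier b (b i) = 1 :=
  (exists_trivialises b p.sMul p.isCocycle).choose_spec.2 i

/-- The strict homotopy obtained from a lax homotopy over a free group. -/
noncomputable def LaxHtpy.strictify (p : LaxHtpy f f') : Htpy f f' :=
  (p.change (p.strictifier b)).toHtpy (trivialises_iff.1 (p.trivialises_strictifier b))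

theorem LaxHtpy.toLax_strictify (p : LaxHtpy f f') :
    (p.strictify b).toLax = p.change (p.strictifier b) :=
  LaxHtpy.toLax_toHtpy _ _

theorem LaxHtpy.strictify_s_basis (p : LaxHtpy f f') (i : ι) :
    (p.strictify b).s (b i) = p.s (b i) := by
  change p.s (b i) * A'.δ (p.strictifier b (b i)) = _
  rw [p.strictifier_basis, map_one, mul_one]

/-- By uniqueness of trivialisations, a strict homotopy reached by a change that is trivial on the
basis must be the normal form. -/
theorem LaxHtpy.eq_strictify {p : LaxHtpy f f'} {q : Htpy f f'} {k : A.G → A'.L}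
    (h : q.toLax = p.change k) (hk : ∀ i, k (b i) = 1) : q = p.strictify b := by
  have e : k = p.strictifier b :=
    Trivialises.unique b (trivialises_iff.2 (congrArg LaxHtpy.P h).symm)
      (p.trivialises_strictifier b) p.sMul p.isCocycle
      fun i => by rw [hk, p.strictifier_basis]
  apply Htpy.toLax_injective
  rw [h, e, p.toLax_strictify]

theorem Htpy.strictify_toLax (p : Htpy f f') : p.toLax.strictify b = p :=
  (LaxHtpy.eq_strictify b p.toLax.change_one.symm fun _ => rfl).symm

theorem LaxHtpy.strictify_change (p : LaxHtpy f f') {k : A.G → A'.L} (hk : ∀ i, k (b i) = 1) :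
    (p.change k).strictify b = p.strictify b := by
  refine LaxHtpy.eq_strictify b (k := k * (p.change k).strictifier b) ?_ fun i => ?_
  · rw [LaxHtpy.change_mul, LaxHtpy.toLax_strictify]
  · rw [Pi.mul_apply, hk, LaxHtpy.strictifier_basis, one_mul]

/-- Strictifying a factor only alters the product by a change trivial on the basis, so
strictification can be postponed to the end. Units, associativity and inverses of strict homotopies
then reduce to the lax ones. -/
theorem LaxHtpy.strictify_comp_left (p : LaxHtpy f f') (q : LaxHtpy f' f'') :
    ((p.strictify b).toLax.comp q).strictify b = (p.comp q).strictify b := by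
  rw [LaxHtpy.toLax_strictify, LaxHtpy.change_comp]
  exact LaxHtpy.strictify_change b _ fun i => by rw [p.strictifier_basis, sec_one_right]

theorem LaxHtpy.strictify_comp_right (p : LaxHtpy f f') (q : LaxHtpy f' f'') :
    (p.comp (q.strictify b).toLax).strictify b = (p.comp q).strictify b := by
  rw [LaxHtpy.toLax_strictify, LaxHtpy.comp_change]
  exact LaxHtpy.strictify_change b _ (q.strictifier_basis b)

/-- A change of lax homotopies induces a 2-fold homotopy of their strictifications. -/
noncomputable def Htpy₂.strictify {p q : LaxHtpy f f'} (m : A.G → A'.L) (h : q = p.change m) :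
    Htpy₂ (p.strictify b) (q.strictify b) :=
  .ofEq ((p.strictifier b)⁻¹ * m * q.strictifier b) (by
    rw [LaxHtpy.change_mul, LaxHtpy.change_mul, p.toLax_strictify, ← LaxHtpy.change_mul p,
      mul_inv_cancel, p.change_one, ← h, q.toLax_strictify])

theorem Htpy₂.strictify_k_basis {p q : LaxHtpy f f'} (m : A.G → A'.L) (h : q = p.change m)
    (i : ι) : (Htpy₂.strictify b m h).k (b i) = m (b i) := by
  change (p.strictifier b (b i))⁻¹ * m (b i) * q.strictifier b (b i) = _
  rw [p.strictifier_basis, q.strictifier_basis]; simp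

variable (A') in
/-- The homotopies and 2-fold homotopies over a free group, labelled by their values on the
basis. -/
noncomputable def strictCells : LabelledCells (Hom A A') Htpy (fun _ _ => Htpy₂) (ι → A'.L) where
  id₁ f := (LaxHtpy.id f).strictify b
  comp₁ p q := (p.toLax.comp q.toLax).strictify b
  id_comp p := by
    rw [LaxHtpy.strictify_comp_left, LaxHtpy.id_comp, Htpy.strictify_toLax]
  comp_id p := by
    rw [LaxHtpy.strictify_comp_right, LaxHtpy.comp_id, Htpy.strictify_toLax]
  assoc p q r := by
    rw [LaxHtpy.strictify_comp_left, LaxHtpy.strictify_comp_right, LaxHtpy.comp_assoc]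
  inv₁ p := ⟨p.toLax.inv.strictify b,
    by rw [LaxHtpy.strictify_comp_right, LaxHtpy.comp_inv],
    by rw [LaxHtpy.strictify_comp_left, LaxHtpy.inv_comp]⟩
  label η i := η.k (b i)
  -- A 2-derivation trivialises the cocycle 1, hence is determined by its values on the basis.
  label_injective _ _ h := Htpy₂.ext_basis b (congrFun h)
  id₂ p := .ofEq 1 p.toLax.change_one.symm
  label_id₂ _ := rfl
  comp₂ η θ := .ofEq (η.k * θ.k) (by rw [LaxHtpy.change_mul, ← η.eq_change, ← θ.eq_change])
  label_comp₂ _ _ := rfl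
  inv₂ η := .ofEq η.k⁻¹ (by
    rw [η.eq_change, ← LaxHtpy.change_mul, mul_inv_cancel, LaxHtpy.change_one])
  label_inv₂ _ := rfl
  whiskerLeft r _ _ η := Htpy₂.strictify b η.k (by rw [η.eq_change, LaxHtpy.comp_change])
  label_whiskerLeft _ _ _ _ := funext (Htpy₂.strictify_k_basis b _ _)
  act r := secPiHom fun i => r.s (b i)
  act_id f m := by
    refine Eq.trans ?_ (secPiHom_one m)
    congr 2
    funext i
    rw [LaxHtpy.strictify_s_basis]; rfl
  act_comp p q m := by
    refine Eq.trans ?_ (secPiHom_mul (fun i => p.s (b i)) (fun i => q.s (b i)) m)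
    congr 2
    funext i
    rw [LaxHtpy.strictify_s_basis]; rfl
  act_label η := secPiHom_mul_eq fun i => η.s_eq (b i)
  whiskerRight η r := Htpy₂.strictify b _ (by rw [η.eq_change, LaxHtpy.change_comp])
  label_whiskerRight _ _ := funext (Htpy₂.strictify_k_basis b _ _)

end Strictify

/-! ### Concatenation of strict homotopies through the triangle group -/

section Concat

variable {A : TwoCrossedModule.{u}} {A' : TwoCrossedModule.{v}} {f f' f'' : Hom A A'}

theorem triangle_mul_identity (e x a : A'.E) (l m : A'.L) :
    A'.sec (x * A'.δ m)⁻¹ (A'.pl e (a * A'.δ l)⁻¹ * (A'.bd e • l⁻¹)) * m⁻¹ =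
      (A'.sec (e⁻¹ * x)⁻¹ l * m)⁻¹ * A'.sec x⁻¹ (A'.pl e a⁻¹) := by
  rw [mul_inv_rev x, mul_inv_rev a, ← map_inv A'.δ, ← map_inv A'.δ, δ_mul_sec, pl_δ_mul_right,
    mul_inv_rev e⁻¹, inv_inv, mul_sec]
  simp only [smul_inv', sec_mul, sec_inv]
  group

/-- The group morphism into the triangle space defining the concatenation of `p` and `q`. -/
def triangleHom (p : Htpy f f') (q : Htpy f' f'') {k : A.G → A'.L}
    (hk : Trivialises f.φ (p.toLax.comp q.toLax).s (p.toLax.comp q.toLax).P k) :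
    A.G →ₙ* Triangle A' where
  -- The second and third coordinates multiply to the strictified s(g)s'(g)δk(g). The last is the
  -- factor by which strictification changes the t-component.
  toFun g := ⟨f.φ g, p.s g, q.s g * A'.δ (k g), (k g)⁻¹⟩
  map_mul' g h := by
    have e := hk g h
    have e1 := p.isQuadraticDerivation.s_mul g h
    have e2 := (p.toLax.comp q.toLax).sMul g h
    change compP f.φ f'.φ p.s q.s 1 1 g h * k (g * h) = _ at e
    change p.s (g * h) * q.s (g * h) = (f.φ h)⁻¹ • (p.s g * q.s g) * (p.s h * q.s h) *
      A'.δ (compP f.φ f'.φ p.s q.s 1 1 g h) at e2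
    have e3 : compP f.φ f'.φ p.s q.s 1 1 g h =
        A'.sec (q.s h)⁻¹ (A'.pl (p.s h)⁻¹ ((f.φ h)⁻¹ • (q.s g)⁻¹)) := by
      simp [compP, sec_one_right]
    refine Triangle.ext (map_mul _ _ _) e1 ?_ ?_
    · change q.s (g * h) * A'.δ (k (g * h)) = (f.φ h)⁻¹ • (f.φ h • (p.s h)⁻¹ *
        (q.s g * A'.δ (k g)) * (f.φ h • (p.s h)⁻¹)⁻¹) * (q.s h * A'.δ (k h))
      rw [e1] at e2
      rw [eq_inv_mul_of_mul_eq e, map_mul, map_inv, map_mul, lact_apply, δ_sec, ← mul_assoc,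
        eq_inv_mul_of_mul_eq e2]
      simp only [smul_mul', smul_inv', inv_smul_smul, A'.δ_smul, LaxHtpy.comp, LaxHtpy.mk',
        Htpy.toLax, Pi.mul_apply]
      group
    · change (k (g * h))⁻¹ = A'.sec (q.s h * A'.δ (k h))⁻¹ ((f.φ h)⁻¹ • (
        A'.pl (f.φ h • (p.s h)⁻¹) (q.s g * A'.δ (k g))⁻¹ *
          A'.bd (f.φ h • (p.s h)⁻¹) • (k g)⁻¹)) * (k h)⁻¹
      have e4 := triangle_mul_identity (p.s h)⁻¹ (q.s h) ((f.φ h)⁻¹ • q.s g) ((f.φ h)⁻¹ • k g)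
        (k h)
      have e5 : (f.φ h)⁻¹ • A'.bd (f.φ h • (p.s h)⁻¹) • (k g)⁻¹ =
          A'.bd (p.s h)⁻¹ • ((f.φ h)⁻¹ • k g)⁻¹ := by
        rw [A'.bd_smul, ← smul_inv', smul_smul, smul_smul]; group
      rw [eq_inv_mul_of_mul_eq e, e3, mul_inv_rev, inv_inv, smul_mul', e5, A'.smul_pl,
        inv_smul_smul, smul_inv' _ (_ * _), smul_mul', ← A'.δ_smul, e4, inv_inv, ← smul_inv']
      rfl

variable {ι : Type u} (b : FreeGroupBasis ι A.G)

theorem isConcat_strictify (p : Htpy f f') (q : Htpy f' f'') :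
    IsConcat b p q ((p.toLax.comp q.toLax).strictify b) := by
  refine ⟨LaxHtpy.strictify_s_basis b _,
    triangleHom p q ((p.toLax.comp q.toLax).trivialises_strictifier b), fun i => ?_, fun e => ?_⟩
  · refine Triangle.ext rfl rfl ?_ ?_
    · change q.s (b i) * A'.δ _ = q.s (b i)
      rw [LaxHtpy.strictifier_basis, map_one, mul_one]
    · change (_)⁻¹ = _
      rw [LaxHtpy.strictifier_basis, inv_one]
  · exact (mul_assoc _ _ _).symm

theorem isHOM_twoGroupoid : IsHOM b (strictCells A' b).twoGroupoid where
  id₁ f := by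
    have h : (LaxHtpy.id f).strictify b = (LaxHtpy.id f).toHtpy rfl :=
      ((LaxHtpy.id f).toHtpy rfl).strictify_toLax b
    change (∀ g, ((LaxHtpy.id f).strictify b).s g = 1) ∧ ∀ e, ((LaxHtpy.id f).strictify b).t e = 1
    rw [h]
    exact ⟨fun _ => rfl, fun _ => rfl⟩
  comp₁ := isConcat_strictify b
  id₂ _ _ := rfl
  vcomp _ _ _ := rfl
  whiskerRight η r := congrFun ((strictCells A' b).label_whiskerRight η r)
  whiskerLeft r _ _ η := congrFun ((strictCells A' b).label_whiskerLeft r η)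

end Concat

section Precomp

variable {A B : TwoCrossedModule.{u}} {A' : TwoCrossedModule.{v}} {f f' f'' : Hom A A'}

/-! ### Precomposition of lax homotopies with a strict map -/

/-- Precomposition of a lax homotopy with a strict map. -/
def LaxHtpy.precomp (p : LaxHtpy f f') (π : Hom B A) : LaxHtpy (f.comp π) (f'.comp π) where
  s u := p.s (π.φ u)
  t x := p.t (π.ψ x)
  P u v := p.P (π.φ u) (π.φ v)
  bd_s_mul u v := by rw [map_mul]; exact p.bd_s_mul _ _
  s_mul u v := by rw [map_mul]; exact p.s_mul _ _
  t_mul x y := by rw [map_mul, π.φ_bd, π.φ_bd]; exact p.t_mul _ _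
  t_smul u x := by
    rw [π.ψ_smul, π.φ_bd, map_one, map_inv, map_mul, map_inv, π.φ_bd]; exact p.t_smul _ _
  P_cocycle u v i := by rw [map_mul, map_mul]; exact p.P_cocycle _ _ _
  φ_eq u := p.φ_eq _
  ψ_eq x := by rw [π.φ_bd]; exact p.ψ_eq _
  μ_eq l := by rw [π.ψ_δ, map_one]; exact p.μ_eq _

theorem LaxHtpy.precomp_comp (p : LaxHtpy f f') (q : LaxHtpy f' f'') (π : Hom B A) :
    (p.comp q).precomp π = (p.precomp π).comp (q.precomp π) := by
  refine LaxHtpy.ext_fun (fun u => rfl) (fun x => ?_) (fun u v => rfl)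
  change compT q.s p.t q.t (π.ψ x) = compT _ _ _ x
  rw [compT, compT, ← π.φ_bd]; rfl

theorem LaxHtpy.precomp_change (p : LaxHtpy f f') (k : A.G → A'.L) (π : Hom B A) :
    (p.change k).precomp π = (p.precomp π).change (fun u => k (π.φ u)) := by
  refine LaxHtpy.ext_fun (fun u => rfl) (fun x => ?_) (fun u v => ?_)
  · change (k (A.bd (π.ψ x)))⁻¹ * _ = (k (π.φ (B.bd x)))⁻¹ * _
    rw [π.φ_bd]; rfl
  · change changeP f.φ p.s k p.P (π.φ u) (π.φ v) =
      changeP (f.φ.comp π.φ) (fun u => p.s (π.φ u)) (fun u => k (π.φ u))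
        (fun u v => p.P (π.φ u) (π.φ v)) u v
    rw [changeP, changeP, map_mul]; rfl

theorem LaxHtpy.precomp_injective {π : Hom B A} (hφ : Function.Surjective π.φ)
    (hψ : Function.Surjective π.ψ) {p q : LaxHtpy f f'} (h : p.precomp π = q.precomp π) :
    p = q :=
  LaxHtpy.ext_fun
    (hφ.forall.2 fun u => congrFun (congrArg LaxHtpy.s h) u)
    (hψ.forall.2 fun x => congrFun (congrArg LaxHtpy.t h) x)
    (hφ.forall.2 fun u => hφ.forall.2 fun v => congrFun (congrFun (congrArg LaxHtpy.P h) u) v)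

/-- A lax homotopy whose components factor through a surjective strict map. -/
def LaxHtpy.descend {π : Hom B A} (hφ : Function.Surjective π.φ) (hψ : Function.Surjective π.ψ)
    (hμ : Function.Surjective π.μ) (y : LaxHtpy (f.comp π) (f'.comp π)) (s : A.G → A'.E)
    (t : A.E → A'.L) (P : A.G → A.G → A'.L) (hs : ∀ u, y.s u = s (π.φ u))
    (ht : ∀ x, y.t x = t (π.ψ x)) (hP : ∀ u v, y.P u v = P (π.φ u) (π.φ v)) : LaxHtpy f f' where
  s := s
  t := t
  P := P
  bd_s_mul := hφ.forall.2 fun u => hφ.forall.2 fun v => by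
    have e := y.bd_s_mul u v
    simp only [hs, map_mul π.φ] at e
    exact e
  s_mul := hφ.forall.2 fun u => hφ.forall.2 fun v => by
    have e := y.s_mul u v
    simp only [hs, hP, map_mul π.φ] at e
    exact e
  t_mul := hψ.forall.2 fun x => hψ.forall.2 fun z => by
    have e := y.t_mul x z
    simp only [hs, ht, hP, map_mul π.ψ, π.φ_bd] at e
    exact e
  t_smul := hφ.forall.2 fun u => hψ.forall.2 fun x => by
    have e := y.t_smul u x
    simp only [hs, ht, hP, π.φ_bd, π.ψ_smul, map_mul π.φ, map_inv π.φ, map_one π.φ] at e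
    exact e
  P_cocycle := hφ.forall.2 fun u => hφ.forall.2 fun v => hφ.forall.2 fun i => by
    have e := y.P_cocycle u v i
    simp only [hs, hP, map_mul π.φ] at e
    exact e
  φ_eq := hφ.forall.2 fun u => by
    have e := y.φ_eq u
    simp only [hs] at e
    exact e
  ψ_eq := hψ.forall.2 fun x => by
    have e := y.ψ_eq x
    simp only [hs, ht, π.φ_bd] at e
    exact e
  μ_eq := hμ.forall.2 fun l => by
    have e := y.μ_eq l
    simp only [ht, hP, π.ψ_δ, map_one π.φ] at e
    exact e

theorem Hom.comp_injective {π : Hom B A} (hφ : Function.Surjective π.φ)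
    (hψ : Function.Surjective π.ψ) (hμ : Function.Surjective π.μ)
    (h : f.comp π = f'.comp π) : f = f' :=
  Hom.ext
    (MonoidHom.ext (hμ.forall.2 fun l => DFunLike.congr_fun (congrArg Hom.μ h) l))
    (MonoidHom.ext (hψ.forall.2 fun x => DFunLike.congr_fun (congrArg Hom.ψ h) x))
    (MonoidHom.ext (hφ.forall.2 fun u => DFunLike.congr_fun (congrArg Hom.φ h) u))

theorem LaxHtpy.t_one (p : LaxHtpy f f') : p.t 1 = p.P 1 1 := by
  have e := p.μ_eq 1
  rw [map_one, map_one, map_one, one_mul] at e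
  exact (inv_mul_eq_one.1 e.symm).symm

end Precomp

/-! ### The partial resolution -/

section Resolution

variable (A : TwoCrossedModule.{u})

theorem proj_φ_basis (g : A.G) : A.proj.φ (A.Q1basis g) = g :=
  FreeGroup.lift_apply_of

theorem proj_φ_surjective : Function.Surjective A.proj.φ := fun g => ⟨_, A.proj_φ_basis g⟩

theorem bd_genE (e : A.E) : A.Q1.bd (A.genE e) = A.Q1basis (A.bd e) := rfl

theorem proj_ψ_genE (e : A.E) : A.proj.ψ (A.genE e) = e := rfl

theorem proj_ψ_surjective : Function.Surjective A.proj.ψ := fun e => ⟨A.genE e, rfl⟩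

theorem proj_μ_surjective : Function.Surjective A.proj.μ := fun l => ⟨l, rfl⟩

theorem bd_genK (g h : A.G) :
    A.Q1.bd (A.genK g h) = (A.Q1basis (g * h))⁻¹ * A.Q1basis g * A.Q1basis h := rfl

theorem proj_ψ_genK (g h : A.G) : A.proj.ψ (A.genK g h) = 1 := rfl

variable {A}

theorem Q1_ext {x y : A.Q1.E} (h : A.proj.ψ x = A.proj.ψ y) (h' : A.Q1.bd x = A.Q1.bd y) :
    x = y :=
  Subtype.ext (Prod.ext h h')

/-- The element `(1, n)` of the principal group of `Q¹(A)`, for `n` in the kernel of the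
projection. -/
def kerE (n : A.Q1.G) (hn : A.proj.φ n = 1) : A.Q1.E :=
  ⟨(1, n), by rw [mem_pullback, map_one]; exact hn.symm⟩

theorem bd_kerE (n : A.Q1.G) (hn : A.proj.φ n = 1) : A.Q1.bd (kerE n hn) = n := rfl

theorem proj_ψ_kerE (n : A.Q1.G) (hn : A.proj.φ n = 1) : A.proj.ψ (kerE n hn) = 1 := rfl

theorem kerE_mul (n m : A.Q1.G) (hn : A.proj.φ n = 1) (hm : A.proj.φ m = 1) :
    kerE (n * m) (by rw [map_mul, hn, hm, mul_one]) = kerE n hn * kerE m hm :=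
  Q1_ext (mul_one (1 : A.E)).symm rfl

theorem kerE_smul (u n : A.Q1.G) (hn : A.proj.φ n = 1) :
    kerE (u * n * u⁻¹) (by rw [map_mul, map_mul, hn, mul_one, map_inv, mul_inv_cancel]) =
      u • kerE n hn :=
  Q1_ext (by rw [A.proj.ψ_smul, proj_ψ_kerE, proj_ψ_kerE, smul_one])
    (by rw [A.Q1.bd_smul, bd_kerE, bd_kerE])

/-- The defect `[p(u)]⁻¹ u`. -/
def defect (u : A.Q1.G) : A.Q1.G := (A.Q1basis (A.proj.φ u))⁻¹ * u

theorem proj_φ_defect (u : A.Q1.G) : A.proj.φ (defect u) = 1 := by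
  rw [defect, map_mul, map_inv, proj_φ_basis, inv_mul_cancel]

theorem basis_mul_defect (u : A.Q1.G) : A.Q1basis (A.proj.φ u) * defect u = u :=
  mul_inv_cancel_left _ _

theorem defect_basis (g : A.G) : defect (A.Q1basis g) = 1 := by
  rw [defect, proj_φ_basis, inv_mul_cancel]

/-- Splits any (e, u) as (e, [∂e])·(1, n) with n in the kernel of `proj.φ`, so that t over Q¹(A) is
governed by its values on these two kinds of element. -/
theorem genE_mul_kerE (x : A.Q1.E) :
    A.genE (A.proj.ψ x) * kerE (defect (A.Q1.bd x)) (proj_φ_defect _) = x :=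
  Q1_ext (by rw [map_mul, proj_ψ_genE, proj_ψ_kerE, mul_one])
    (by rw [map_mul, bd_genE, bd_kerE, ← A.proj.φ_bd, basis_mul_defect])

end Resolution

/-! ### Label-preserving strict 2-functors -/

section LabelledFunctor

open Bicategory

variable {Obj : Type*} {Cell₁ : Obj → Obj → Type*}
  {Cell₂ : ∀ ⦃a b : Obj⦄, Cell₁ a b → Cell₁ a b → Type*}
  {Obj' : Type*} {Cell₁' : Obj' → Obj' → Type*}
  {Cell₂' : ∀ ⦃a b : Obj'⦄, Cell₁' a b → Cell₁' a b → Type*} {M : Type*} [Group M]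

/-- A strict 2-functor between 2-groupoids of labelled cells that preserves labels. -/
def LabelledCells.functor (D : LabelledCells Obj Cell₁ Cell₂ M)
    (D' : LabelledCells Obj' Cell₁' Cell₂' M) (obj : Obj → Obj')
    (map : ∀ {a b}, Cell₁ a b → Cell₁' (obj a) (obj b))
    (map_id : ∀ a, map (D.id₁ a) = D'.id₁ (obj a))
    (map_comp : ∀ {a b c} (p : Cell₁ a b) (q : Cell₁ b c),
      map (D.comp₁ p q) = D'.comp₁ (map p) (map q))
    (map_act : ∀ {a b} (p : Cell₁ a b) (m : M), D'.act (map p) m = D.act p m)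
    (map₂ : ∀ {a b} {p q : Cell₁ a b}, Cell₂ p q → Cell₂' (map p) (map q))
    (label_map₂ : ∀ {a b} {p q : Cell₁ a b} (η : Cell₂ p q), D'.label (map₂ η) = D.label η) :
    letI := D.bicategory
    letI := D'.bicategory
    StrictPseudofunctor Obj Obj' :=
  letI := D.bicategory
  letI := D'.bicategory
  letI : Strict Obj := D.twoGroupoid.strict
  letI : Strict Obj' := D'.twoGroupoid.strict
  .mk'' {
    obj := obj
    map := map
    map₂ := map₂
    map₂_id := fun p => D'.label_injective _ _ (by
      rw [label_map₂, D'.label_id, D.label_id])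
    map₂_comp := fun η θ => D'.label_injective _ _ (by
      rw [label_map₂, D'.label_comp, D.label_comp, label_map₂, label_map₂])
    map_id := map_id
    map_comp := map_comp
    map₂_whisker_left := fun f _ _ η => D'.label_injective _ _ (by
      rw [D'.label_comp, D'.label_comp, D'.label_eqToHom, D'.label_eqToHom, one_mul, mul_one,
        label_map₂]
      exact (D.label_whiskerLeft f η).trans
        ((label_map₂ η).symm.trans (D'.label_whiskerLeft (map f) (map₂ η)).symm))
    map₂_whisker_right := fun η f => D'.label_injective _ _ (by
      rw [D'.label_comp, D'.label_comp, D'.label_eqToHom, D'.label_eqToHom, one_mul, mul_one,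
        label_map₂]
      refine (D.label_whiskerRight η f).trans
        (Eq.trans ?_ (D'.label_whiskerRight (map₂ η) (map f)).symm)
      rw [label_map₂, map_act]) }

end LabelledFunctor

/-! ### The comparison with Q¹(A) and its injectivity -/

section Inclusion

variable {A : TwoCrossedModule.{u}} {A' : TwoCrossedModule.{v}} {f f' f'' : Hom A A'}

/-- The strict homotopy over `Q¹(A)` corresponding to a lax homotopy. -/
noncomputable def LaxHtpy.resolve (p : LaxHtpy f f') : Htpy (f.comp A.proj) (f'.comp A.proj) :=
  (p.precomp A.proj).strictify A.Q1basis

theorem LaxHtpy.resolve_id (f : Hom A A') :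
    (LaxHtpy.id f).resolve = (LaxHtpy.id (f.comp A.proj)).strictify A.Q1basis := rfl

theorem LaxHtpy.resolve_comp (p : LaxHtpy f f') (q : LaxHtpy f' f'') :
    (p.comp q).resolve = (p.resolve.toLax.comp q.resolve.toLax).strictify A.Q1basis := by
  rw [LaxHtpy.resolve, LaxHtpy.resolve, LaxHtpy.resolve, LaxHtpy.strictify_comp_left,
    LaxHtpy.strictify_comp_right, LaxHtpy.precomp_comp]

/-- The 2-fold homotopy over `Q¹(A)` corresponding to a lax 2-fold homotopy. -/
noncomputable def LaxHtpy₂.resolve {p q : LaxHtpy f f'} (η : LaxHtpy₂ p q) :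
    Htpy₂ p.resolve q.resolve :=
  Htpy₂.strictify A.Q1basis (fun u => η.k (A.proj.φ u))
    (by rw [← LaxHtpy.precomp_change, ← η.eq_change])

theorem LaxHtpy₂.resolve_k_basis {p q : LaxHtpy f f'} (η : LaxHtpy₂ p q) (g : A.G) :
    η.resolve.k (A.Q1basis g) = η.k g := by
  rw [LaxHtpy₂.resolve, Htpy₂.strictify_k_basis, proj_φ_basis]

theorem LaxHtpy.resolve_s_basis (p : LaxHtpy f f') (g : A.G) :
    p.resolve.s (A.Q1basis g) = p.s g := by
  rw [LaxHtpy.resolve, LaxHtpy.strictify_s_basis]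
  exact congrArg p.s (A.proj_φ_basis g)

theorem LaxHtpy.resolve_t (p : LaxHtpy f f') (x : A.Q1.E) :
    p.resolve.t x = ((p.precomp A.proj).strictifier A.Q1basis (A.Q1.bd x))⁻¹ * p.t (A.proj.ψ x) :=
  rfl

theorem LaxHtpy.resolve_t_genE (p : LaxHtpy f f') (e : A.E) :
    p.resolve.t (A.genE e) = p.t e := by
  rw [LaxHtpy.resolve_t, bd_genE, LaxHtpy.strictifier_basis, inv_one, one_mul, proj_ψ_genE]

theorem LaxHtpy.resolve_t_genK (p : LaxHtpy f f') (g h : A.G) :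
    p.resolve.t (A.genK g h) = p.P g h := by
  set b := A.Q1basis with hb
  -- The strictifier at [g][h] is computed from two factorisations, [g]·[h] and [gh]·([gh]⁻¹[g][h]).
  -- The resulting P(1,1) cancels against t(1) = P(1,1).
  have e1 := (p.precomp A.proj).trivialises_strictifier b (b g) (b h)
  have e2 := (p.precomp A.proj).trivialises_strictifier b (b (g * h)) ((b (g * h))⁻¹ * b g * b h)
  have e3 : (p.precomp A.proj).P (b g) (b h) = p.P g h := by
    change p.P (A.proj.φ _) (A.proj.φ _) = _
    rw [hb, proj_φ_basis, proj_φ_basis]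
  have e4 : (p.precomp A.proj).P (b (g * h)) ((b (g * h))⁻¹ * b g * b h) = p.P 1 1 := by
    change p.P (A.proj.φ _) (A.proj.φ _) = _
    rw [map_mul A.proj.φ, map_mul A.proj.φ, map_inv A.proj.φ, hb, proj_φ_basis, proj_φ_basis,
      proj_φ_basis, mul_assoc, inv_mul_cancel, p.isCocycle.right_one p.sMul]
  have e5 : b (g * h) * ((b (g * h))⁻¹ * b g * b h) = b g * b h := by group
  rw [LaxHtpy.strictifier_basis, LaxHtpy.strictifier_basis, map_one, mul_one, e3] at e1
  rw [LaxHtpy.strictifier_basis, map_one, one_mul, e5, e4] at e2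
  rw [LaxHtpy.resolve_t, bd_genK, ← hb, ← e2, proj_ψ_genK, p.t_one, eq_inv_of_mul_eq_one_right e1]
  group

theorem LaxHtpy.resolve_injective :
    Function.Injective (LaxHtpy.resolve (f := f) (f' := f')) := fun p q h =>
  LaxHtpy.ext_fun
    (fun g => by rw [← p.resolve_s_basis, h, q.resolve_s_basis])
    (fun e => by rw [← p.resolve_t_genE, h, q.resolve_t_genE])
    (fun g i => by rw [← p.resolve_t_genK, h, q.resolve_t_genK])

theorem LaxHtpy₂.resolve_injective {p q : LaxHtpy f f'} :
    Function.Injective (LaxHtpy₂.resolve (p := p) (q := q)) := fun η θ h =>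
  LaxHtpy₂.ext (funext fun g => by rw [← η.resolve_k_basis, h, θ.resolve_k_basis])

/-! ### Surjectivity on 2-fold homotopies -/

/-- The t-component at (1, n) forces m to be constant on the kernel. The P-component at (v, n) then
makes m(vn) independent of n. -/
theorem LaxHtpy.change_descends {p q : LaxHtpy f f'} {m : A.Q1.G → A'.L}
    (h : q.precomp A.proj = (p.precomp A.proj).change m) (u : A.Q1.G) :
    m u = m (A.Q1basis (A.proj.φ u)) := by
  have h1 (n : A.Q1.G) (hn : A.proj.φ n = 1) : m n = p.t 1 * (q.t 1)⁻¹ := by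
    have e : q.t 1 = (m n)⁻¹ * p.t 1 := congrFun (congrArg LaxHtpy.t h) (kerE n hn)
    rw [e]; group
  have h2 (v n : A.Q1.G) (hn : A.proj.φ n = 1) : m (v * n) =
      (p.P (A.proj.φ v) 1)⁻¹ * (lact f.φ p.s 1 (m v) * (p.t 1 * (q.t 1)⁻¹)) *
        q.P (A.proj.φ v) 1 := by
    have e : q.P (A.proj.φ v) (A.proj.φ n) =
        (lact f.φ p.s (A.proj.φ n) (m v) * m n)⁻¹ * p.P (A.proj.φ v) (A.proj.φ n) * m (v * n) :=
      congrFun (congrFun (congrArg LaxHtpy.P h) v) n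
    rw [hn, h1 n hn] at e
    rw [e]; group
  have h3 := h2 (A.Q1basis (A.proj.φ u)) 1 (map_one _)
  rw [mul_one] at h3
  conv_lhs => rw [← basis_mul_defect u]
  rw [h2 _ _ (proj_φ_defect u), ← h3]

theorem LaxHtpy₂.resolve_surjective {p q : LaxHtpy f f'} :
    Function.Surjective (LaxHtpy₂.resolve (p := p) (q := q)) := fun θ => by
  -- m strictifies p, applies θ, then undoes the strictification of q. It is a change between the
  -- precomposed lax homotopies and agrees with θ on the basis.
  obtain ⟨m, hm⟩ : ∃ m, m = (p.precomp A.proj).strictifier A.Q1basis *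
      θ.k * ((q.precomp A.proj).strictifier A.Q1basis)⁻¹ := ⟨_, rfl⟩
  have e : q.precomp A.proj = (p.precomp A.proj).change m := by
    have e : (q.precomp A.proj).change ((q.precomp A.proj).strictifier A.Q1basis) =
        ((p.precomp A.proj).change ((p.precomp A.proj).strictifier A.Q1basis)).change θ.k := by
      rw [← LaxHtpy.toLax_strictify, ← LaxHtpy.toLax_strictify]
      exact θ.eq_change
    rw [hm, LaxHtpy.change_mul, LaxHtpy.change_mul, ← e, ← LaxHtpy.change_mul, mul_inv_cancel,
      LaxHtpy.change_one]
  have e' : q = p.change fun g => m (A.Q1basis g) := by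
    apply LaxHtpy.precomp_injective A.proj_φ_surjective A.proj_ψ_surjective
    rw [e, LaxHtpy.precomp_change]
    exact congrArg _ (funext (LaxHtpy.change_descends e))
  refine ⟨.ofEq _ e', Htpy₂.ext_basis A.Q1basis fun g => ?_⟩
  rw [LaxHtpy₂.resolve_k_basis]
  change m (A.Q1basis g) = _
  rw [hm, Pi.mul_apply, Pi.mul_apply, Pi.inv_apply, LaxHtpy.strictifier_basis,
    LaxHtpy.strictifier_basis, inv_one, one_mul, mul_one]

/-! ### Surjectivity on homotopies -/

end Inclusion

section Essential

variable {A : TwoCrossedModule.{u}} {A' : TwoCrossedModule.{v}} {f f' : Hom A A'}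

/-! ### Surjectivity on homotopies -/

section Kernel

variable (h : Htpy (f.comp A.proj) (f'.comp A.proj))

/-- The value of `t` at `(1, n)`, for `n` in the kernel of the projection. -/
def Htpy.tKer (n : A.Q1.G) (hn : A.proj.φ n = 1) : A'.L := h.t (kerE n hn)

theorem Htpy.comp_proj_ψ_kerE (f : Hom A A') (n : A.Q1.G) (hn : A.proj.φ n = 1) :
    (f.comp A.proj).ψ (kerE n hn) = 1 := map_one f.ψ

theorem Htpy.s_ker (n : A.Q1.G) (hn : A.proj.φ n = 1) : h.s n = (A'.δ (h.tKer n hn))⁻¹ := by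
  have e := h.ψ_eq (kerE n hn)
  rw [Htpy.comp_proj_ψ_kerE, Htpy.comp_proj_ψ_kerE, one_mul, bd_kerE] at e
  exact eq_inv_of_mul_eq_one_left e.symm

theorem Htpy.t_mul_kerE (x : A.Q1.E) (n : A.Q1.G) (hn : A.proj.φ n = 1) :
    h.t (x * kerE n hn) = h.tKer n hn * h.t x := by
  have e := h.toLax.tMul x (kerE n hn)
  change 1 * h.t (x * kerE n hn) = A'.sec (h.s n)⁻¹ ((A'.pl ((f.comp A.proj).ψ (kerE n hn))⁻¹ _)⁻¹ *
    A'.sec ((f.comp A.proj).ψ (kerE n hn))⁻¹ (h.t x)) * h.tKer n hn at e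
  rw [Htpy.comp_proj_ψ_kerE, inv_one, pl_one_left, sec_one_left, h.s_ker n hn, inv_inv, inv_one,
    one_mul, one_mul, sec_δ, inv_mul_cancel_right] at e
  exact e

theorem Htpy.tKer_one : h.tKer 1 (map_one _) = 1 := h.toLax.t_one

theorem Htpy.tKer_mul (n m : A.Q1.G) (hn : A.proj.φ n = 1) (hm : A.proj.φ m = 1)
    (hnm : A.proj.φ (n * m) = 1) : h.tKer (n * m) hnm = h.tKer m hm * h.tKer n hn := by
  rw [Htpy.tKer, kerE_mul n m hn hm, h.t_mul_kerE]; rfl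

/-- At (1, n) we have ψ = 1 and s(n)δt(1,n) = 1, so every lifting in `TSmul` is trivial. -/
theorem Htpy.lact_tKer (u n : A.Q1.G) (hn : A.proj.φ n = 1) (hun : A.proj.φ (u * n * u⁻¹) = 1) :
    lact (f.comp A.proj).φ h.s u (h.tKer (u * n * u⁻¹) hun) = h.tKer n hn := by
  have e := h.toLax.tSmul u (kerE n hn)
  rw [← kerE_smul, Htpy.comp_proj_ψ_kerE, inv_one, pl_one_left, one_mul] at e
  change 1 * 1⁻¹ * lact (f.comp A.proj).φ h.s u (h.tKer (u * n * u⁻¹) hun) =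
    A'.sec (h.s n)⁻¹ 1⁻¹ * h.tKer n hn *
      (A'.pl (h.s u)⁻¹ (A'.bd (h.s u) • (h.s n * A'.δ (h.tKer n hn))⁻¹))⁻¹ at e
  rw [h.s_ker n hn, inv_mul_cancel] at e
  simpa only [inv_one, smul_one, pl_one_right, sec_one_right, one_mul, mul_one] using e

/-- The map making `h` constant along the fibres of the projection. -/
def Htpy.descender (u : A.Q1.G) : A'.L := h.tKer (defect u) (proj_φ_defect u)

theorem Htpy.descender_basis (g : A.G) : h.descender (A.Q1basis g) = 1 := by
  rw [← h.tKer_one]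
  simp only [Htpy.descender, defect_basis]

theorem Htpy.s_mul_δ_descender (u : A.Q1.G) :
    h.s u * A'.δ (h.descender u) = h.s (A.Q1basis (A.proj.φ u)) := by
  have e := h.isQuadraticDerivation.s_mul (A.Q1basis (A.proj.φ u)) (defect u)
  have e' : (f.comp A.proj).φ (defect u) = 1 := by
    change f.φ (A.proj.φ _) = 1
    rw [proj_φ_defect, map_one]
  rw [basis_mul_defect, e', inv_one, one_smul, h.s_ker _ (proj_φ_defect u)] at e
  rw [e]
  exact inv_mul_cancel_right _ _

theorem Htpy.descender_inv_mul_t (x : A.Q1.E) :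
    (h.descender (A.Q1.bd x))⁻¹ * h.t x = h.t (A.genE (A.proj.ψ x)) := by
  conv_lhs => rw [← genE_mul_kerE x]
  rw [h.t_mul_kerE, genE_mul_kerE]
  exact inv_mul_cancel_left _ _

/-- With g, i the images of u, v, the defect of uv is [gi]⁻¹[g][i] · [i]⁻¹defect(u)[i] · defect(v).
As `tKer` reverses products, the last two factors cancel in `changeP` and only the value at `genK g
i` survives. -/
theorem Htpy.changeP_descender (u v : A.Q1.G) :
    changeP (f.comp A.proj).φ h.s h.descender 1 u v =
      h.t (A.genK (A.proj.φ u) (A.proj.φ v)) := by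
  set b := A.Q1basis with hb
  set g := A.proj.φ u with hg
  set i := A.proj.φ v with hi
  have hc : A.proj.φ ((b (g * i))⁻¹ * b g * b i) = 1 := by
    rw [map_mul A.proj.φ, map_mul A.proj.φ, map_inv A.proj.φ, hb, proj_φ_basis, proj_φ_basis,
      proj_φ_basis]
    group
  have hn := proj_φ_defect u
  have hm := proj_φ_defect v
  have hn' : A.proj.φ ((b i)⁻¹ * defect u * b i) = 1 := by
    rw [map_mul A.proj.φ, map_mul A.proj.φ, hn, map_inv A.proj.φ]
    group
  have hr : b i * ((b i)⁻¹ * defect u * b i) * (b i)⁻¹ = defect u := by group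
  -- Since s(v)δ(descender v) = s([i]), `lact` at v is `lact` at [i] up to conjugation by the
  -- descender, and at [i] `lact_tKer` applies.
  have hl : lact (f.comp A.proj).φ h.s v (h.descender u) =
      h.tKer _ hm * h.tKer _ hn' * (h.tKer _ hm)⁻¹ := by
    have e := h.lact_tKer (b i) _ hn' (by rw [hr]; exact hn)
    simp only [hr] at e
    have e2 := lact_mul_δ (f.comp A.proj).φ h.s h.descender v (h.descender u)
    have e3 : (f.comp A.proj).φ v = (f.comp A.proj).φ (b i) :=
      congrArg f.φ (A.proj_φ_basis i).symm
    rw [lact_apply, h.s_mul_δ_descender, e3, ← hi, ← hb, ← lact_apply] at e2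
    have e4 := e.symm.trans e2
    change h.tKer _ hn' = (h.tKer _ hm)⁻¹ * _ * h.tKer _ hm at e4
    rw [e4]; group
  have hd : defect (u * v) = (b (g * i))⁻¹ * b g * b i * ((b i)⁻¹ * defect u * b i) * defect v := by
    rw [defect, defect, defect, map_mul A.proj.φ, ← hg, ← hi, ← hb]; group
  have hk : h.descender (u * v) = h.tKer _ hm * (h.tKer _ hn' * h.tKer _ hc) := by
    have h1 : A.proj.φ ((b (g * i))⁻¹ * b g * b i * ((b i)⁻¹ * defect u * b i)) = 1 := by
      rw [map_mul, hc, hn', mul_one]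
    rw [← h.tKer_mul _ _ hc hn' h1, ← h.tKer_mul _ _ h1 hm (by rw [map_mul, h1, hm, mul_one])]
    simp only [Htpy.descender, hd]
  rw [changeP, hl, hk]
  change (h.tKer _ hm * h.tKer _ hn' * (h.tKer _ hm)⁻¹ * h.tKer _ hm)⁻¹ * 1 * _ = h.tKer _ hc
  group

end Kernel

theorem LaxHtpy.resolve_surjective :
    Function.Surjective (LaxHtpy.resolve (f := f) (f' := f')) := fun h => by
  obtain ⟨p, hp⟩ : ∃ p : LaxHtpy f f', p.precomp A.proj = h.toLax.change h.descender :=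
    ⟨(h.toLax.change h.descender).descend A.proj_φ_surjective A.proj_ψ_surjective
      A.proj_μ_surjective (fun g => h.s (A.Q1basis g)) (fun e => h.t (A.genE e))
      (fun g i => h.t (A.genK g i)) h.s_mul_δ_descender h.descender_inv_mul_t
      h.changeP_descender,
      (LaxHtpy.ext_fun h.s_mul_δ_descender h.descender_inv_mul_t h.changeP_descender).symm⟩
  -- Undoing the descender is a change trivial on the basis that returns h, so h is the
  -- strictification of the pullback of p.
  refine ⟨p, (LaxHtpy.eq_strictify A.Q1basis (k := h.descender⁻¹) ?_ fun g => ?_).symm⟩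
  · rw [hp, ← LaxHtpy.change_mul, mul_inv_cancel, LaxHtpy.change_one]
  · rw [Pi.inv_apply, h.descender_basis, inv_one]

variable (A A')

/-- The inclusion of the 2-groupoid of lax homotopies into the 2-groupoid of strict homotopies
over the partial resolution. -/
noncomputable def resolveFunctor :
    letI := (laxCells A A').bicategory
    letI := (strictCells A' A.Q1basis).bicategory
    StrictPseudofunctor (Hom A A') (Hom A.Q1 A') :=
  (laxCells A A').functor (strictCells A' A.Q1basis) (fun f => f.comp A.proj) LaxHtpy.resolve
    LaxHtpy.resolve_id LaxHtpy.resolve_comp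
    (fun p m => congrArg (secPiHom · m) (funext p.resolve_s_basis)) LaxHtpy₂.resolve
    (fun η => funext η.resolve_k_basis)

theorem isFullOnStrictMaps :
    IsFullOnStrictMaps (laxCells A A').twoGroupoid (strictCells A' A.Q1basis).twoGroupoid :=
  ⟨resolveFunctor A A', fun _ => rfl,
    fun _ _ => Hom.comp_injective A.proj_φ_surjective A.proj_ψ_surjective A.proj_μ_surjective,
    fun _ _ => ⟨LaxHtpy.resolve_injective, LaxHtpy.resolve_surjective⟩,
    fun _ _ _ _ => ⟨LaxHtpy₂.resolve_injective, LaxHtpy₂.resolve_surjective⟩,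
    fun _ _ p => ⟨LaxHtpy.resolve_s_basis p, LaxHtpy.resolve_t_genE p, LaxHtpy.resolve_t_genK p⟩,
    fun _ _ _ _ η => LaxHtpy₂.resolve_k_basis η⟩

end Essential

end TwoCrossedModule

theorem mainTheorem9 (A : TwoCrossedModule.{u}) (A' : TwoCrossedModule.{v}) :
    ∃ (T : TwoCrossedModule.TwoGroupoidOn (TwoCrossedModule.Hom A A')
          TwoCrossedModule.LaxHtpy (fun _ _ => TwoCrossedModule.LaxHtpy₂))
      (S : TwoCrossedModule.TwoGroupoidOn (TwoCrossedModule.Hom A.Q1 A')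
          TwoCrossedModule.Htpy (fun _ _ => TwoCrossedModule.Htpy₂)),
      TwoCrossedModule.IsHOMLax T ∧
      TwoCrossedModule.IsHOM A.Q1basis S ∧
      TwoCrossedModule.IsFullOnStrictMaps T S :=
  ⟨(TwoCrossedModule.laxCells A A').twoGroupoid,
    (TwoCrossedModule.strictCells A' A.Q1basis).twoGroupoid,
    TwoCrossedModule.isHOMLax_twoGroupoid, TwoCrossedModule.isHOM_twoGroupoid A.Q1basis,
    TwoCrossedModule.isFullOnStrictMaps A A'⟩
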